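/- **Conventions.** Spaces are compactly generated Hausdorff, with compactly generated products. A (nonsymmetric) topological operad $\mathscr C$ consists of spaces $\mathscr C(n)$, $n\ge 0$, with $\mathscr C(0)$ a point, continuous maps $\gamma:\mathscr C(k)\times\mathscr C(m_1)\times\cdots\times\mathscr C(m_k)\to\mathscr C(m_1+\cdots+m_k)$ and $1\in\mathscr C(1)$ satisfying the usual associativity and unit laws; a (discrete) operad is the same with sets. $\mathscr C$ is path-connected if every $\mathscr C(n)$ is. Products in $S_n$ are $\sigma\cdot\tau=\tau\circ\sigma$. In the symmetric groups operad $\mathscr S=\{S_n\}$, $\gamma(\sigma;\tau_1,\dots,\tau_k)$ sends the $j$-th letter of the $i$-th block (blocks of sizes $m_1,\dots,m_k$) to the $\tau_i(j)$-th letter of the $\sigma(i)$-th block (blocks of sizes $m_{\sigma^{-1}(1)},\dots,m_{\sigma^{-1}(k)}$). A *group operad* is an operad $\mathscr G=\{G_n\}$ of groups together with a morphism of operads $\pi:\mathscr G\to\mathscr S$ consisting of homomorphisms, such that the identity of $G_1$ is the operad unit and, writing $a(i)=(\pi a)(i)$, $$\gamma(aa';b_1b_1',\dots,b_kb_k')=\gamma(a;b_1,\dots,b_k)\,\gamma(a';b'_{a^{-1}(1)},\dots,b'_{a^{-1}(k)}).$$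 It is *non-crossed* if $\pi$ is trivial. A *$\mathscr G$-operad* is an operad $\mathscr X$ with left actions of $G_n$ on $\mathscr X(n)$ (continuous in the topological case) such that $$\gamma(\sigma a;\tau_1b_1,\dots,\tau_kb_k)=\gamma(\sigma;\tau_1,\dots,\tau_k)\,\gamma(a;b_{\sigma^{-1}(1)},\dots,b_{\sigma^{-1}(k)}).$$ A symmetric operad is an $\mathscr S$-operad; it is *covering* if each $S_n$ acts on $\mathscr C(n)$ by a covering action, i.e. every point has a neighborhood disjoint from its translates by non-identity elements. Let $\mathscr C_1$ be the little intervals operad, $c_k=([0,\frac1k],\dots,[\frac{k-1}k,1])$, $\mathscr C_1(k)_0$ the path component of $c_k$ in $\mathscr C_1(k)$, and $(\mathscr C_1)_0=\{\mathscr C_1(k)_0\}$ the resulting nonsymmetric suboperad. A *good basepoint* of $\mathscr C$ is $e_k=\eta(c_k)$ for a chosen continuous morphism of nonsymmetric operads $\eta:(\mathscr C_1)_0\to\mathscr C$. For $m=m_1+\cdots+m_k$ let $\delta$ be the path from $e_m$ to $\gamma(e_k;e_{m_1},\dots,e_{m_k})$ that is the image under $\eta$ of the linear path from $c_m$ to $\gamma(c_k;c_{m_1},\dots,c_{m_k})$.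 **Theorem.** (1) Let $\mathscr C$ be a path-connected nonsymmetric topological operad with a good basepoint. Let $\pi_l\mathscr C=\{\pi_l(\mathscr C(k),e_k)\}_{k\ge0}$, $l\geq 1$, have as unit the class of the constant map at $e_1=1$, and $$\gamma([f];[g_1],\dots,[g_k])=\delta_*[\gamma(f;g_1,\dots,g_k)],$$ where $\gamma(f;g_1,\dots,g_k)$ is formed pointwise and $\delta_*$ is the change of basepoint along $\delta$; for $l=1$ this is $[\delta][\gamma(f;g_1,\dots,g_k)][\delta]^{-1}$. Then $\pi_1\mathscr C$ is a non-crossed group operad and, for every $l\ge1$, $\pi_l\mathscr C$ with the usual action of $\pi_1(\mathscr C(k),e_k)$ on $\pi_l(\mathscr C(k),e_k)$ is a $\pi_1\mathscr C$-operad. (2) Let $\mathscr C$ be a path-connected covering symmetric topological operad with a good basepoint. Let $L_k$ be the set of pairs consisting of $\sigma\in S_k$ and a homotopy class (relative to the endpoints) of paths in $\mathscr C(k)$ from $e_k$ to $\sigma e_k$. The quotient maps $\mathscr C(k)\to\mathscr C(k)/S_k$ induce bijections $L_k\to\pi_1(\mathscr C(k)/S_k,S_ke_k)$, and bijections $\pi_l(\mathscr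 C(k),e_k)\to\pi_l(\mathscr C(k)/S_k,S_ke_k)$ for $l>1$. Let $\pi_1(\mathscr C/\mathscr S)=\{\pi_1(\mathscr C(k)/S_k,S_ke_k)\}_{k\ge0}$, with $\pi:\pi_1(\mathscr C(k)/S_k,S_ke_k)\to S_k$, $(\sigma,[f])\mapsto\sigma$, with the class of the constant path as unit, and with $\gamma((\sigma,[f]);(\tau_1,[g_1]),\dots,(\tau_k,[g_k]))$ the class over $\gamma(\sigma;\tau_1,\dots,\tau_k)$ of the path $$\delta_1\cdot\gamma(f;g_1,\dots,g_k)\cdot\gamma(\sigma;\tau_1,\dots,\tau_k)\delta_2^{-1},$$ where $\delta_1:e_m\to\gamma(e_k;e_{m_1},\dots,e_{m_k})$ and $\delta_2:e_m\to\gamma(e_k;e_{m_{\sigma^{-1}(1)}},\dots,e_{m_{\sigma^{-1}(k)}})$ are the paths defined above. For $l>1$ let $\pi_l(\mathscr C/\mathscr S)=\{\pi_l(\mathscr C(k)/S_k,S_ke_k)\}_{k\ge0}$ have the operad operations carried over from $\pi_l\mathscr C$ by the bijections. Then $\pi_1(\mathscr C/\mathscr S)$ is a group operad and, for every $l>1$,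 $\pi_l(\mathscr C/\mathscr S)$ with the usual action of $\pi_1(\mathscr C(k)/S_k,S_ke_k)$ on $\pi_l(\mathscr C(k)/S_k,S_ke_k)$ is a $\pi_1(\mathscr C/\mathscr S)$-operad. -/

import Mathlib

open scoped Topology Topology.Homotopy

universe u v

noncomputable section

/-! ### Arity bookkeeping -/

/-- The identification of the `j`-th input of the `i`-th block with an input of the composite:
blocks are concatenated in their natural order. -/
def blk {k N : ℕ} (m : Fin k → ℕ) (h : N = ∑ i, m i) : (Σ i, Fin (m i)) ≃ Fin N :=
  finSigmaFinEquiv.trans (finCongr h.symm)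

theorem blk_lt {k N : ℕ} (m : Fin k → ℕ) (h : N = ∑ i, m i) {i i' : Fin k} (hi : i < i')
    (j : Fin (m i)) (j' : Fin (m i')) : blk m h ⟨i, j⟩ < blk m h ⟨i', j'⟩ := by
  have key : ∀ (r : ℕ) (hr : r ≤ k), (i : ℕ) < r →
      ∑ x : Fin (i : ℕ), m (Fin.castLE i.2.le x) + m i ≤ ∑ x : Fin r, m (Fin.castLE hr x) := by
    intro r
    induction r with
    | zero => intro _ h0; omega
    | succ r ih =>
      intro hr hir
      rw [Fin.sum_univ_castSucc]
      rcases Nat.lt_succ_iff_lt_or_eq.mp hir with h1 | h1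
      · exact (ih (by omega) h1).trans (Nat.le_add_right _ _)
      · subst h1; exact le_rfl
  subst h
  have h1 := finSigmaFinEquiv_apply (n := m) ⟨i, j⟩
  have h2 := finSigmaFinEquiv_apply (n := m) ⟨i', j'⟩
  have h3 := key i' i'.2.le hi
  have h4 := j.2
  change ((finSigmaFinEquiv (n := m) ⟨i, j⟩ : Fin _) : ℕ)
    < ((finSigmaFinEquiv (n := m) ⟨i', j'⟩ : Fin _) : ℕ)
  dsimp only at h1 h2
  omega

theorem blk_lt_iff_snd {k N : ℕ} (m : Fin k → ℕ) (h : N = ∑ i, m i) (i : Fin k)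
    (j j' : Fin (m i)) : blk m h ⟨i, j⟩ < blk m h ⟨i, j'⟩ ↔ j < j' := by
  subst h
  have h1 := finSigmaFinEquiv_apply (n := m) ⟨i, j⟩
  have h2 := finSigmaFinEquiv_apply (n := m) ⟨i, j'⟩
  change ((finSigmaFinEquiv (n := m) ⟨i, j⟩ : Fin _) : ℕ)
    < ((finSigmaFinEquiv (n := m) ⟨i, j'⟩ : Fin _) : ℕ) ↔ (j : ℕ) < j'
  dsimp only at h1 h2
  omega

/-! ### Operads -/

/-- The operations `γ` and the unit of an operad, without axioms.
`comp m h a b` is `γ(a; b₁, …, b_k)`, an element of arity `N = m₁ + ⋯ + m_k`. -/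
structure OperadOps (C : ℕ → Type v) where
  comp : ∀ {k : ℕ} (m : Fin k → ℕ) {N : ℕ}, N = ∑ i, m i → C k → (∀ i, C (m i)) → C N
  one : C 1

/-- The axioms of an operad (in sets) with `C(0)` a single point. -/
structure OperadOps.IsOperad {C : ℕ → Type v} (O : OperadOps C) : Prop where
  zero_unique : Nonempty (Unique (C 0))
  assoc : ∀ {k : ℕ} (m : Fin k → ℕ) {N : ℕ} (h : N = ∑ i, m i)
    (n : Fin N → ℕ) {M : ℕ} (hM : M = ∑ p, n p)
    (s : Fin k → ℕ) (hs : ∀ i, s i = ∑ j, n (blk m h ⟨i, j⟩)) (hM' : M = ∑ i, s i)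
    (a : C k) (b : ∀ i, C (m i)) (c : ∀ p, C (n p)),
    O.comp n hM (O.comp m h a b) c =
      O.comp s hM' a (fun i => O.comp (fun j => n (blk m h ⟨i, j⟩)) (hs i) (b i)
        (fun j => c (blk m h ⟨i, j⟩)))
  one_comp : ∀ {n : ℕ} (h : n = ∑ _i : Fin 1, n) (a : C n),
    O.comp (fun _ : Fin 1 => n) h O.one (fun _ => a) = a
  comp_one : ∀ {k : ℕ} (h : k = ∑ _i : Fin k, 1) (a : C k),
    O.comp (fun _ : Fin k => 1) h a (fun _ => O.one) = a

/-- Transport of operad operations along bijections. -/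
def OperadOps.transport {C : ℕ → Type u} {D : ℕ → Type v} (O : OperadOps C)
    (e : ∀ n, C n ≃ D n) : OperadOps D where
  comp m _ h a b := e _ (O.comp m h ((e _).symm a) (fun i => (e (m i)).symm (b i)))
  one := e 1 O.one

/-! ### The symmetric groups operad, group operads and their actions -/

/-- The symmetric group with product `σ · τ = τ ∘ σ` (first `σ`, then `τ`). As a function, `σ`
is `σ.unop`, and `σ⁻¹(i)` is `σ.unop.symm i`. -/
abbrev SG (n : ℕ) : Type := (Equiv.Perm (Fin n))ᵐᵒᵖ

theorem sum_perm_eq {k N : ℕ} {m : Fin k → ℕ} (h : N = ∑ i, m i) (σ : Equiv.Perm (Fin k)) :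
    N = ∑ i, m (σ.symm i) :=
  h.trans (Equiv.sum_comp σ.symm m).symm

/-- `γ(σ; τ₁, …, τ_k)` in the symmetric groups operad: the `j`-th input of the `i`-th block goes
to position `τᵢ(j)` of the block at position `σ(i)`; the block at position `i'` of the target has
size `m (σ⁻¹ i')`. -/
def symComp {k : ℕ} (m : Fin k → ℕ) {N : ℕ} (h : N = ∑ i, m i) (σ : SG k)
    (τ : ∀ i, SG (m i)) : SG N :=
  MulOpposite.op
    ((((blk m h).symm.trans (Equiv.sigmaCongrRight fun i => (τ i).unop)).trans
      (Equiv.sigmaCongrLeft' (β := fun i => Fin (m i)) σ.unop)).trans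
      (blk (fun i => m (σ.unop.symm i)) (sum_perm_eq h σ.unop)))

/-- The symmetric groups operad `𝒮`. -/
def symOps : OperadOps SG where
  comp := symComp
  one := 1

/-- `P`, together with `π`, is a group operad: an operad of groups with a morphism of operads `π`
to the symmetric groups operad that consists of homomorphisms, whose unit is the identity of `G₁`
and whose `γ` is a crossed homomorphism. -/
structure IsGroupOperad {G : ℕ → Type v} [∀ n, Group (G n)] (P : OperadOps G)
    (π : ∀ n, G n → SG n) : Prop where
  isOperad : P.IsOperad
  map_mul : ∀ {n : ℕ} (a b : G n), π n (a * b) = π n a * π n b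
  map_unit : π 1 P.one = symOps.one
  map_comp : ∀ {k : ℕ} (m : Fin k → ℕ) {N : ℕ} (h : N = ∑ i, m i) (a : G k) (b : ∀ i, G (m i)),
    π N (P.comp m h a b) = symOps.comp m h (π k a) (fun i => π (m i) (b i))
  unit_eq : P.one = 1
  crossed : ∀ {k : ℕ} (m : Fin k → ℕ) {N : ℕ} (h : N = ∑ i, m i) (a a' : G k)
    (b b' : ∀ i, G (m i)),
    P.comp m h (a * a') (fun i => b i * b' i) =
      P.comp m h a b *
        P.comp (fun i => m ((π k a).unop.symm i)) (sum_perm_eq h _) a'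
          (fun i => b' ((π k a).unop.symm i))

/-- `O` is an operad, and `act` is an action on it of the group operad `(P, π)`. -/
structure IsGOperad {G : ℕ → Type u} [∀ n, Group (G n)] (P : OperadOps G)
    (π : ∀ n, G n → SG n) {X : ℕ → Type v} (O : OperadOps X) (act : ∀ n, G n → X n → X n) :
    Prop where
  isOperad : O.IsOperad
  one_act : ∀ {n : ℕ} (x : X n), act n 1 x = x
  mul_act : ∀ {n : ℕ} (a b : G n) (x : X n), act n (a * b) x = act n a (act n b x)
  equivariant : ∀ {k : ℕ} (m : Fin k → ℕ) {N : ℕ} (h : N = ∑ i, m i) (σ : G k)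
    (τ : ∀ i, G (m i)) (a : X k) (b : ∀ i, X (m i)),
    O.comp m h (act k σ a) (fun i => act (m i) (τ i) (b i)) =
      act N (P.comp m h σ τ)
        (O.comp (fun i => m ((π k σ).unop.symm i)) (sum_perm_eq h _) a
          (fun i => b ((π k σ).unop.symm i)))

/-! ### Topological operads -/

/-- A (nonsymmetric) topological operad. Continuity of `γ` is tested on compact Hausdorff spaces:
for compactly generated Hausdorff `C(n)` this is continuity with respect to the compactly generated
product; it is implied by continuity with respect to the ordinary product topology. -/
structure TopOperad where
  obj : ℕ → Type u
  [top : ∀ n, TopologicalSpace (obj n)]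
  ops : OperadOps obj
  isOperad : ops.IsOperad
  continuous_comp : ∀ {k : ℕ} (m : Fin k → ℕ) {N : ℕ} (h : N = ∑ i, m i)
    (K : Type u) [TopologicalSpace K] [CompactSpace K] [T2Space K]
    (a : K → obj k) (b : ∀ i, K → obj (m i)), Continuous a → (∀ i, Continuous (b i)) →
    Continuous fun x => ops.comp m h (a x) (fun i => b i x)

attribute [instance] TopOperad.top

/-- A symmetric topological operad. -/
structure SymmTopOperad extends TopOperad.{u} where
  [act : ∀ n, MulAction (SG n) (obj n)]
  [continuous_act : ∀ n, ContinuousConstSMul (SG n) (obj n)]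
  isGOperad : IsGOperad symOps (fun _ σ => σ) ops (fun n (σ : SG n) (x : obj n) => σ • x)

attribute [instance] SymmTopOperad.act SymmTopOperad.continuous_act

/-- All the spaces `C(n)` are path-connected. -/
def TopOperad.IsPathConnected (C : TopOperad.{u}) : Prop :=
  ∀ n, PathConnectedSpace (C.obj n)

/-- All the actions of `S_n` on `C(n)` are covering actions: every point has a neighborhood that
is disjoint from all its translates by non-identity elements. -/
def SymmTopOperad.IsCovering (C : SymmTopOperad.{u}) : Prop :=
  ∀ n (x : C.obj n), ∃ U ∈ 𝓝 x, ∀ σ : SG n, (((σ • ·) '' U) ∩ U).Nonempty → σ = 1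

/-! ### The little intervals operad and the component of the standard subdivisions -/

/-- `𝒞₁(k)`: the `k`-tuples of closed subintervals `[(c i).1, (c i).2]` of `[0,1]`, of positive
length, with pairwise disjoint interiors. -/
abbrev LittleIntervals (k : ℕ) : Type :=
  {c : Fin k → ℝ × ℝ // (∀ i, 0 ≤ (c i).1 ∧ (c i).1 < (c i).2 ∧ (c i).2 ≤ 1) ∧
    Pairwise fun i j => Disjoint (Set.Ioo (c i).1 (c i).2) (Set.Ioo (c j).1 (c j).2)}

theorem disjoint_Ioo_iff_of_lt {a b c d : ℝ} (h : a < b) (h' : c < d) :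
    Disjoint (Set.Ioo a b) (Set.Ioo c d) ↔ b ≤ c ∨ d ≤ a := by
  rw [Set.Ioo_disjoint_Ioo, min_le_iff, le_max_iff, le_max_iff]
  constructor
  · rintro ((h1 | h1) | (h1 | h1))
    · linarith
    · exact Or.inl h1
    · exact Or.inr h1
    · linarith
  · rintro (h1 | h1)
    · exact Or.inl (Or.inr h1)
    · exact Or.inr (Or.inl h1)

namespace LittleIntervals

variable {k : ℕ}

/-- The intervals appear in their natural order from left to right. -/
def Ordered (c : LittleIntervals k) : Prop :=
  ∀ i j, i < j → (c.1 i).2 ≤ (c.1 j).1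

/-- Constructor for ordered tuples. -/
def ofOrdered (c : Fin k → ℝ × ℝ) (h : ∀ i, 0 ≤ (c i).1 ∧ (c i).1 < (c i).2 ∧ (c i).2 ≤ 1)
    (h' : ∀ i j, i < j → (c i).2 ≤ (c j).1) : LittleIntervals k :=
  ⟨c, h, fun i j hij => by
    dsimp only
    rw [disjoint_Ioo_iff_of_lt (h i).2.1 (h j).2.1]
    rcases lt_or_gt_of_ne hij with h1 | h1
    · exact Or.inl (h' i j h1)
    · exact Or.inr (h' j i h1)⟩

/-- The standard subdivision `c_k = ([0, 1/k], [1/k, 2/k], …, [(k-1)/k, 1])`. -/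
def std (k : ℕ) : LittleIntervals k :=
  ofOrdered (fun i => ((i : ℝ) / k, ((i : ℝ) + 1) / k))
    (fun i => by
      have hk : (0 : ℝ) < k := by exact_mod_cast i.pos
      refine ⟨by positivity, (div_lt_div_iff_of_pos_right hk).2 (lt_add_one _), ?_⟩
      dsimp only
      rw [div_le_one hk]
      exact_mod_cast i.2)
    (fun i j hij => by
      have hk : (0 : ℝ) < k := by exact_mod_cast i.pos
      have : (i : ℝ) + 1 ≤ j := by exact_mod_cast hij
      simp only
      gcongr)

theorem ordered_std (k : ℕ) : (std k).Ordered := fun i j hij => by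
  have hk : (0 : ℝ) < k := by exact_mod_cast i.pos
  have : (i : ℝ) + 1 ≤ j := by exact_mod_cast hij
  simp only [std, ofOrdered]
  gcongr

/-- The linear path `t ↦ (1 - t) c + t c'` between ordered tuples. -/
def linPath (c c' : LittleIntervals k) (h : c.Ordered) (h' : c'.Ordered) : Path c c' where
  toFun t := ofOrdered
    (fun i => ((1 - (t : ℝ)) * (c.1 i).1 + t * (c'.1 i).1,
      (1 - (t : ℝ)) * (c.1 i).2 + t * (c'.1 i).2))
    (fun i => by
      have h0 := t.2.1
      have h1 : 0 ≤ 1 - (t : ℝ) := sub_nonneg.2 t.2.2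
      obtain ⟨a1, a2, a3⟩ := c.2.1 i
      obtain ⟨b1, b2, b3⟩ := c'.2.1 i
      refine ⟨by positivity, ?_, ?_⟩
      · rcases h0.eq_or_lt with h2 | h2
        · simp only [← h2]; linarith
        · nlinarith [mul_le_mul_of_nonneg_left a2.le h1, mul_lt_mul_of_pos_left b2 h2]
      · nlinarith [mul_le_mul_of_nonneg_left a3 h1, mul_le_mul_of_nonneg_left b3 h0])
    (fun i j hij => by
      have h0 := t.2.1
      have h1 : 0 ≤ 1 - (t : ℝ) := sub_nonneg.2 t.2.2
      have := h i j hij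
      have := h' i j hij
      simp only
      gcongr)
  continuous_toFun := by
    refine Continuous.subtype_mk ?_ _
    fun_prop
  source' := Subtype.ext (by funext i; simp [ofOrdered])
  target' := Subtype.ext (by funext i; simp [ofOrdered])

theorem ordered_linPath (c c' : LittleIntervals k) (h : c.Ordered) (h' : c'.Ordered) (t : unitInterval) :
    (linPath c c' h h' t).Ordered := fun i j hij => by
  have h0 := t.2.1
  have h1 : 0 ≤ 1 - (t : ℝ) := sub_nonneg.2 t.2.2
  have := h i j hij
  have := h' i j hij
  change (1 - (t : ℝ)) * (c.1 i).2 + t * (c'.1 i).2 ≤ (1 - (t : ℝ)) * (c.1 j).1 + t * (c'.1 j).1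
  gcongr

/-- The path component of `c_k` consists of the ordered tuples. -/
theorem joined_std_iff (c : LittleIntervals k) : Joined (std k) c ↔ c.Ordered := by
  refine ⟨fun ⟨p⟩ i j hij => ?_, fun h => ⟨linPath _ _ (ordered_std k) h⟩⟩
  let g : unitInterval → ℝ := fun t => ((p t).1 j).1 - ((p t).1 i).1
  have hg : Continuous g := by
    have h1 : Continuous fun t => (p t).1 := continuous_subtype_val.comp p.continuous
    exact (continuous_fst.comp ((continuous_apply j).comp h1)).sub
      (continuous_fst.comp ((continuous_apply i).comp h1))
  have alt : ∀ d : LittleIntervals k, (d.1 i).2 ≤ (d.1 j).1 ∨ (d.1 j).2 ≤ (d.1 i).1 := fun d =>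
    (disjoint_Ioo_iff_of_lt (d.2.1 i).2.1 (d.2.1 j).2.1).1 (d.2.2 hij.ne)
  have hne : ∀ t, g t ≠ 0 := fun t ht => by
    have h1 := ((p t).2.1 i).2.1
    have h2 := ((p t).2.1 j).2.1
    simp only [g] at ht
    rcases alt (p t) with h | h <;> linarith
  have h0 : 0 < g 0 := by
    simp only [g, p.source]
    have h1 := ((std k).2.1 i).2.1
    linarith [ordered_std k i j hij]
  by_contra hcon
  have h1 : g 1 < 0 := by
    simp only [g, p.target]
    rcases alt c with h | h
    · exact absurd h hcon
    · linarith [(c.2.1 j).2.1]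
  obtain ⟨t, ht⟩ := mem_range_of_exists_le_of_exists_ge hg ⟨1, h1.le⟩ ⟨0, h0.le⟩
  exact hne t ht

/-- Composition in the little intervals operad: the `i`-th tuple `b i` is inserted, by the
increasing affine map `[0,1] → c i`, into the `i`-th interval of `c`. -/
def comp (m : Fin k → ℕ) {N : ℕ} (h : N = ∑ i, m i) (c : LittleIntervals k)
    (b : ∀ i, LittleIntervals (m i)) : LittleIntervals N :=
  ⟨fun p =>
    let q := (blk m h).symm p
    ((c.1 q.1).1 + ((c.1 q.1).2 - (c.1 q.1).1) * ((b q.1).1 q.2).1,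
      (c.1 q.1).1 + ((c.1 q.1).2 - (c.1 q.1).1) * ((b q.1).1 q.2).2), by
    have key : ∀ q : (Σ i, Fin (m i)),
        (c.1 q.1).1 ≤ (c.1 q.1).1 + ((c.1 q.1).2 - (c.1 q.1).1) * ((b q.1).1 q.2).1 ∧
        (c.1 q.1).1 + ((c.1 q.1).2 - (c.1 q.1).1) * ((b q.1).1 q.2).1 <
          (c.1 q.1).1 + ((c.1 q.1).2 - (c.1 q.1).1) * ((b q.1).1 q.2).2 ∧
        (c.1 q.1).1 + ((c.1 q.1).2 - (c.1 q.1).1) * ((b q.1).1 q.2).2 ≤ (c.1 q.1).2 := by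
      intro q
      obtain ⟨a1, a2, a3⟩ := c.2.1 q.1
      obtain ⟨b1, b2, b3⟩ := (b q.1).2.1 q.2
      have hp : 0 < (c.1 q.1).2 - (c.1 q.1).1 := sub_pos.2 a2
      refine ⟨?_, ?_, ?_⟩
      · have := mul_nonneg hp.le b1; linarith
      · have := mul_lt_mul_of_pos_left b2 hp; linarith
      · have := mul_le_mul_of_nonneg_left b3 hp.le; linarith
    refine ⟨fun p => ?_, fun p p' hpp => ?_⟩
    · obtain ⟨h1, h2, h3⟩ := key ((blk m h).symm p)
      obtain ⟨a1, a2, a3⟩ := c.2.1 ((blk m h).symm p).1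
      exact ⟨a1.trans h1, h2, h3.trans a3⟩
    · have hne : (blk m h).symm p ≠ (blk m h).symm p' := fun h => hpp (by simpa using h)
      dsimp only
      generalize (blk m h).symm p = q at *
      generalize (blk m h).symm p' = q' at *
      rw [disjoint_Ioo_iff_of_lt (key q).2.1 (key q').2.1]
      have k1 := key q
      have k2 := key q'
      obtain ⟨i, j⟩ := q
      obtain ⟨i', j'⟩ := q'
      by_cases hi : i = i'
      · subst hi
        have hj : j ≠ j' := fun hj => hne (by rw [hj])
        have hp : 0 ≤ (c.1 i).2 - (c.1 i).1 := (sub_pos.2 (c.2.1 i).2.1).le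
        rcases (disjoint_Ioo_iff_of_lt ((b i).2.1 j).2.1 ((b i).2.1 j').2.1).1 ((b i).2.2 hj)
          with h1 | h1
        · left; have := mul_le_mul_of_nonneg_left h1 hp; simp only; linarith
        · right; have := mul_le_mul_of_nonneg_left h1 hp; simp only; linarith
      · simp only at k1 k2 ⊢
        rcases (disjoint_Ioo_iff_of_lt (c.2.1 i).2.1 (c.2.1 i').2.1).1 (c.2.2 hi) with h1 | h1
        · left; linarith
        · right; linarith⟩

theorem ordered_comp (m : Fin k → ℕ) {N : ℕ} (h : N = ∑ i, m i) {c : LittleIntervals k}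
    {b : ∀ i, LittleIntervals (m i)} (hc : c.Ordered) (hb : ∀ i, (b i).Ordered) :
    (comp m h c b).Ordered := by
  intro p p' hpp
  obtain ⟨⟨i, j⟩, rfl⟩ := (blk m h).surjective p
  obtain ⟨⟨i', j'⟩, rfl⟩ := (blk m h).surjective p'
  have val : ∀ q : (Σ i, Fin (m i)), (comp m h c b).1 (blk m h q) =
      ((c.1 q.1).1 + ((c.1 q.1).2 - (c.1 q.1).1) * ((b q.1).1 q.2).1,
      (c.1 q.1).1 + ((c.1 q.1).2 - (c.1 q.1).1) * ((b q.1).1 q.2).2) := fun q => by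
    conv_rhs => rw [← (blk m h).symm_apply_apply q]
    rfl
  rw [val, val]
  dsimp only
  obtain ⟨a1, a2, a3⟩ := c.2.1 i
  obtain ⟨a1', a2', a3'⟩ := c.2.1 i'
  obtain ⟨b1, b2, b3⟩ := (b i).2.1 j
  obtain ⟨b1', b2', b3'⟩ := (b i').2.1 j'
  rcases lt_trichotomy i i' with hi | hi | hi
  · have h1 := mul_le_mul_of_nonneg_left b3 (sub_pos.2 a2).le
    have h2 := mul_nonneg (sub_pos.2 a2').le b1'
    linarith [hc i i' hi]
  · subst hi
    have := mul_le_mul_of_nonneg_left (hb i j j' ((blk_lt_iff_snd m h i j j').1 hpp))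
      (sub_pos.2 a2).le
    linarith
  · exact absurd hpp (blk_lt m h hi j' j).not_gt

end LittleIntervals

/-- `𝒞₁(k)₀`: the path component of `c_k` in `𝒞₁(k)`. -/
abbrev C10 (k : ℕ) : Type := {c : LittleIntervals k // Joined (LittleIntervals.std k) c}

namespace C10

/-- The standard subdivision `c_k`. -/
def std (k : ℕ) : C10 k := ⟨LittleIntervals.std k, Joined.refl _⟩

/-- The operations of the suboperad `(𝒞₁)₀` of the little intervals operad; the unit is the
interval `[0,1]`. -/
def ops : OperadOps C10 where
  comp m _ h c b := ⟨LittleIntervals.comp m h c.1 (fun i => (b i).1),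
    (LittleIntervals.joined_std_iff _).2 (LittleIntervals.ordered_comp m h
      ((LittleIntervals.joined_std_iff _).1 c.2)
      (fun i => (LittleIntervals.joined_std_iff _).1 (b i).2))⟩
  one := std 1

/-- The linear path `t ↦ (1 - t) c + t c'` in `𝒞₁(k)₀`. -/
def linPath {k : ℕ} (c c' : C10 k) : Path c c' where
  toFun t := ⟨LittleIntervals.linPath c.1 c'.1 ((LittleIntervals.joined_std_iff _).1 c.2)
      ((LittleIntervals.joined_std_iff _).1 c'.2) t,
    (LittleIntervals.joined_std_iff _).2 (LittleIntervals.ordered_linPath _ _ _ _ t)⟩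
  continuous_toFun := Continuous.subtype_mk (Path.continuous _) _
  source' := Subtype.ext (Path.source _)
  target' := Subtype.ext (Path.target _)

end C10

/-- A morphism of nonsymmetric topological operads `η : (𝒞₁)₀ → C`; the sequence `η(c_k)` is the
corresponding good basepoint. -/
structure GoodBasepoint (C : TopOperad.{u}) where
  η : ∀ k, C10 k → C.obj k
  continuous_η : ∀ k, Continuous (η k)
  map_one : η 1 C10.ops.one = C.ops.one
  map_comp : ∀ {k : ℕ} (m : Fin k → ℕ) {N : ℕ} (h : N = ∑ i, m i) (c : C10 k)
    (b : ∀ i, C10 (m i)),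
    η N (C10.ops.comp m h c b) = C.ops.comp m h (η k c) (fun i => η (m i) (b i))

namespace GoodBasepoint

variable {C : TopOperad.{u}} (E : GoodBasepoint C)

/-- The points `e_k = η(c_k)`. -/
def e (k : ℕ) : C.obj k := E.η k (C10.std k)

/-- The linear path `δ` from `e_N` to `γ(e_k; e_{m₁}, …, e_{m_k})`. -/
def δ {k : ℕ} (m : Fin k → ℕ) {N : ℕ} (h : N = ∑ i, m i) :
    Path (E.e N) (C.ops.comp m h (E.e k) (fun i => E.e (m i))) :=
  ((C10.linPath (C10.std N) (C10.ops.comp m h (C10.std k) (fun i => C10.std (m i)))).map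
    (E.continuous_η N)).cast rfl (E.map_comp m h _ _).symm

end GoodBasepoint

/-! ### Fundamental groups and their action on higher homotopy groups -/

/-- The fundamental group, with product `[f][g] = [f · g]` (first `f`, then `g`). -/
def Pi1 (X : Type u) [TopologicalSpace X] (x : X) : Type u := Path.Homotopic.Quotient x x

instance (X : Type u) [TopologicalSpace X] (x : X) : Group (Pi1 X x) where
  mul a b := Path.Homotopic.Quotient.trans a b
  one := Path.Homotopic.Quotient.refl x
  inv a := Path.Homotopic.Quotient.symm a
  mul_assoc a b c := by
    induction a using Quotient.inductionOn with | _ a => ?_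
    induction b using Quotient.inductionOn with | _ b => ?_
    induction c using Quotient.inductionOn with | _ c => ?_
    exact Quotient.sound ⟨Path.Homotopy.transAssoc a b c⟩
  one_mul a := by
    induction a using Quotient.inductionOn with | _ a => ?_
    exact Quotient.sound ⟨Path.Homotopy.reflTrans a⟩
  mul_one a := by
    induction a using Quotient.inductionOn with | _ a => ?_
    exact Quotient.sound ⟨Path.Homotopy.transRefl a⟩
  inv_mul_cancel a := by
    induction a using Quotient.inductionOn with | _ a => ?_
    exact Quotient.sound ⟨(Path.Homotopy.reflSymmTrans a).symm⟩

section Shell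

variable {l : ℕ}

/-- Distance from the center of the cube, rescaled to take the value `1` on the boundary. -/
def cubeRad (t : Fin l → unitInterval) : ℝ := ‖fun i => 2 * (t i : ℝ) - 1‖

/-- The map stretching the inner cube `[1/4, 3/4]^l` onto the cube. -/
def cubeInner (t : Fin l → unitInterval) : Fin l → unitInterval := fun i =>
  Set.projIcc (0 : ℝ) 1 zero_le_one (2 * (t i : ℝ) - 1 / 2)

/-- The collapse of the shell around the inner cube to the interval: the boundary of the cube goes
to `0` and the boundary of the inner cube goes to `1`. -/
def cubeOuter (t : Fin l → unitInterval) : unitInterval := Set.projIcc (0 : ℝ) 1 zero_le_one (2 - 2 * cubeRad t)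

theorem continuous_cubeRad : Continuous (cubeRad (l := l)) := by
  unfold cubeRad; fun_prop

theorem continuous_cubeInner : Continuous (cubeInner (l := l)) := by
  refine continuous_pi fun i => ?_
  exact continuous_projIcc.comp (by fun_prop)

theorem continuous_cubeOuter : Continuous (cubeOuter (l := l)) :=
  continuous_projIcc.comp (continuous_const.sub (continuous_const.mul continuous_cubeRad))

theorem cubeOuter_of_rad_eq {t : Fin l → unitInterval} (h : cubeRad t = 1 / 2) : cubeOuter t = 1 := by
  unfold cubeOuter
  rw [h]
  exact Set.projIcc_of_right_le _ (by norm_num)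

theorem cubeInner_of_rad_eq {t : Fin l → unitInterval} (h : cubeRad t = 1 / 2) :
    cubeInner t ∈ Cube.boundary (Fin l) := by
  by_contra hcon
  have hlt : cubeRad t < 1 / 2 := by
    refine (pi_norm_lt_iff (by norm_num)).2 fun i => ?_
    rw [Real.norm_eq_abs, abs_lt]
    have h0 : cubeInner t i ≠ 0 := fun h0 => hcon ⟨i, Or.inl h0⟩
    have h1 : cubeInner t i ≠ 1 := fun h1 => hcon ⟨i, Or.inr h1⟩
    constructor
    · by_contra hle
      exact h0 (Set.projIcc_of_le_left _ (by linarith))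
    · by_contra hle
      exact h1 (Set.projIcc_of_right_le _ (by linarith))
  exact absurd h hlt.ne

theorem cubeRad_of_mem_boundary {t : Fin l → unitInterval} (h : t ∈ Cube.boundary (Fin l)) :
    1 ≤ cubeRad t := by
  obtain ⟨i, hi⟩ := h
  have h1 := norm_le_pi_norm (fun i => 2 * (t i : ℝ) - 1) i
  refine le_trans ?_ h1
  rcases hi with hi | hi <;> simp only [hi] <;> norm_num

theorem cubeOuter_of_mem_boundary {t : Fin l → unitInterval} (h : t ∈ Cube.boundary (Fin l)) :
    cubeOuter t = 0 :=
  Set.projIcc_of_le_left _ (by linarith [cubeRad_of_mem_boundary h])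

variable {X : Type u} [TopologicalSpace X]

theorem continuous_shell {K : Type v} [TopologicalSpace K] (P : K → unitInterval → X)
    (F : K → (Fin l → unitInterval) → X)
    (hP : Continuous (Function.uncurry P)) (hF : Continuous (Function.uncurry F))
    (h : ∀ s, ∀ t ∈ Cube.boundary (Fin l), F s t = P s 1) :
    Continuous fun x : K × (Fin l → unitInterval) =>
      if cubeRad x.2 ≤ 1 / 2 then F x.1 (cubeInner x.2) else P x.1 (cubeOuter x.2) := by
  refine Continuous.if_le ?_ ?_ (continuous_cubeRad.comp continuous_snd) continuous_const ?_
  · exact hF.comp (continuous_fst.prodMk (continuous_cubeInner.comp continuous_snd))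
  · exact hP.comp (continuous_fst.prodMk (continuous_cubeOuter.comp continuous_snd))
  · intro x hx
    rw [cubeOuter_of_rad_eq hx]
    exact h _ _ (cubeInner_of_rad_eq hx)

/-- The map `S^l → S^l ∨ S^l → I ∨ S^l → X` given by a path `p` from `x` to `y` and a map `f`
based at `y`, in terms of cubes: `f` on the inner cube, and `p` (from the outside to the inside) on
the shell around it. -/
def shell {x y : X} (p : Path x y) (f : GenLoop (Fin l) X y) : GenLoop (Fin l) X x :=
  ⟨⟨fun t => if cubeRad t ≤ 1 / 2 then f (cubeInner t) else p (cubeOuter t), by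
      have := continuous_shell (K := Unit) (fun _ => p) (fun _ => f)
        (p.continuous.comp continuous_snd) (f.1.continuous.comp continuous_snd)
        (fun _ t ht => (f.2 t ht).trans p.target.symm)
      exact this.comp (g := _) (f := fun t => ((), t)) (continuous_const.prodMk continuous_id)⟩, fun t ht => by
    have h1 := cubeRad_of_mem_boundary ht
    change (if cubeRad t ≤ 1 / 2 then f (cubeInner t) else p (cubeOuter t)) = x
    rw [if_neg (by linarith), cubeOuter_of_mem_boundary ht, p.source]⟩

theorem shell_homotopic {x y : X} {p p' : Path x y} (hp : p.Homotopic p')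
    {f f' : GenLoop (Fin l) X y} (hf : GenLoop.Homotopic f f') :
    GenLoop.Homotopic (shell p f) (shell p' f') := by
  obtain ⟨P⟩ := hp
  obtain ⟨F⟩ := hf
  refine ⟨⟨⟨⟨fun x => if cubeRad x.2 ≤ 1 / 2 then F (x.1, cubeInner x.2)
    else P (x.1, cubeOuter x.2), ?_⟩, ?_, ?_⟩, ?_⟩⟩
  · refine continuous_shell (fun s u => P (s, u)) (fun s t => F (s, t)) P.continuous F.continuous ?_
    intro s t ht
    rw [F.eq_fst s ht, P.target]
    exact f.2 t ht
  · intro t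
    change (if _ then _ else _) = if _ then _ else _
    simp only [F.apply_zero, P.apply_zero]
    rfl
  · intro t
    change (if _ then _ else _) = if _ then _ else _
    simp only [F.apply_one, P.apply_one]
    rfl
  · intro s t ht
    have h1 := cubeRad_of_mem_boundary ht
    change (if _ then _ else _) = (shell p f) t
    rw [show (shell p f) t = x from (shell p f).2 t ht]
    dsimp only
    rw [if_neg (by linarith), cubeOuter_of_mem_boundary ht, P.source]

/-- The change of basepoint `π_l(X, y) → π_l(X, x)` along a homotopy class of paths from `x` to
`y`. -/
def transportPi {x y : X} (p : Path.Homotopic.Quotient x y) (f : π_ l X y) : π_ l X x :=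
  Quotient.map₂ shell (fun _ _ hp _ _ hf => shell_homotopic hp hf) p f

/-- The usual action `[a] ⋆ [f]` of `π₁(X, x)` on `π_l(X, x)`. -/
def piAct {x : X} (a : Pi1 X x) (f : π_ l X x) : π_ l X x := transportPi a f

/-- The map induced on `π_l`. -/
def piMap {Y : Type v} [TopologicalSpace Y] (q : C(X, Y)) (x : X) (f : π_ l X x) : π_ l Y (q x) :=
  Quotient.map (fun f : GenLoop (Fin l) X x =>
      (⟨q.comp f.1, fun t ht => congrArg q (f.2 t ht)⟩ : GenLoop (Fin l) Y (q x)))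
    (fun _ _ h => ContinuousMap.HomotopicRel.comp_continuousMap h q) f

end Shell

/-! ### `γ` on paths and on spheres -/

namespace TopOperad

variable (C : TopOperad.{u}) {k : ℕ} (m : Fin k → ℕ) {N : ℕ} (h : N = ∑ i, m i)

theorem continuous_comp_of_compact {K : Type} [TopologicalSpace K] [CompactSpace K] [T2Space K]
    {a : K → C.obj k} {b : ∀ i, K → C.obj (m i)} (ha : Continuous a)
    (hb : ∀ i, Continuous (b i)) : Continuous fun x => C.ops.comp m h (a x) (fun i => b i x) :=
  (C.continuous_comp m h (ULift.{u} K) (fun x => a x.down) (fun i x => b i x.down)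
    (ha.comp continuous_uliftDown) (fun i => (hb i).comp continuous_uliftDown)).comp
    continuous_uliftUp

variable {a a' : C.obj k} {b b' : ∀ i, C.obj (m i)}

/-- The path `γ(f; g₁, …, g_k)`. -/
def pathComp (f : Path a a') (g : ∀ i, Path (b i) (b' i)) :
    Path (C.ops.comp m h a b) (C.ops.comp m h a' b') where
  toFun t := C.ops.comp m h (f t) (fun i => g i t)
  continuous_toFun := C.continuous_comp_of_compact m h f.continuous (fun i => (g i).continuous)
  source' := by simp
  target' := by simp

theorem pathComp_homotopic {f f' : Path a a'} {g g' : ∀ i, Path (b i) (b' i)}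
    (hf : f.Homotopic f') (hg : ∀ i, (g i).Homotopic (g' i)) :
    (C.pathComp m h f g).Homotopic (C.pathComp m h f' g') := by
  obtain ⟨F⟩ := hf
  have G := fun i => (hg i).some
  refine ⟨⟨⟨⟨fun x => C.ops.comp m h (F x) (fun i => G i x),
    C.continuous_comp_of_compact m h F.continuous (fun i => (G i).continuous)⟩, ?_, ?_⟩, ?_⟩⟩
  · intro t; simp [pathComp]
  · intro t; simp [pathComp]
  · rintro s t (rfl | rfl) <;> simp [pathComp]

/-- `γ` on homotopy classes of paths: `γ([f]; [g₁], …, [g_k]) = [γ(f; g₁, …, g_k)]`. -/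
def pathCompQ (f : Path.Homotopic.Quotient a a')
    (g : ∀ i, Path.Homotopic.Quotient (b i) (b' i)) :
    Path.Homotopic.Quotient (C.ops.comp m h a b) (C.ops.comp m h a' b') :=
  .mk (C.pathComp m h (Quotient.out f) (fun i => Quotient.out (g i)))

theorem pathCompQ_mk (f : Path a a') (g : ∀ i, Path (b i) (b' i)) :
    C.pathCompQ m h (.mk f) (fun i => .mk (g i)) = .mk (C.pathComp m h f g) :=
  Path.Homotopic.Quotient.eq.2
    (C.pathComp_homotopic m h (Quotient.mk_out (s := Path.Homotopic.setoid _ _) f)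
      (fun i => Quotient.mk_out (s := Path.Homotopic.setoid _ _) (g i)))

variable {l : ℕ}

/-- The map `γ(f; g₁, …, g_k)`, `t ↦ γ(f(t); g₁(t), …, g_k(t))`. -/
def loopComp (f : GenLoop (Fin l) (C.obj k) a) (g : ∀ i, GenLoop (Fin l) (C.obj (m i)) (b i)) :
    GenLoop (Fin l) (C.obj N) (C.ops.comp m h a b) :=
  ⟨⟨fun t => C.ops.comp m h (f t) (fun i => g i t),
    C.continuous_comp_of_compact m h f.1.continuous (fun i => (g i).1.continuous)⟩,
    fun t ht => by
      change C.ops.comp m h (f t) (fun i => g i t) = _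
      rw [show f t = a from f.2 t ht, show (fun i => g i t) = b from
        funext fun i => (g i).2 t ht]⟩

theorem loopComp_homotopic {f f' : GenLoop (Fin l) (C.obj k) a}
    {g g' : ∀ i, GenLoop (Fin l) (C.obj (m i)) (b i)} (hf : GenLoop.Homotopic f f')
    (hg : ∀ i, GenLoop.Homotopic (g i) (g' i)) :
    GenLoop.Homotopic (C.loopComp m h f g) (C.loopComp m h f' g') := by
  obtain ⟨F⟩ := hf
  have G := fun i => (hg i).some
  refine ⟨⟨⟨⟨fun x => C.ops.comp m h (F x) (fun i => G i x),
    C.continuous_comp_of_compact m h F.continuous (fun i => (G i).continuous)⟩, ?_, ?_⟩, ?_⟩⟩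
  · intro t
    simp only [ContinuousMap.HomotopyWith.apply_zero]
    rfl
  · intro t
    simp only [ContinuousMap.HomotopyWith.apply_one]
    rfl
  · intro s t ht
    change C.ops.comp m h (F (s, t)) (fun i => G i (s, t)) =
      C.ops.comp m h (f t) (fun i => g i t)
    rw [F.eq_fst s ht, show (fun i => G i (s, t)) = fun i => g i t from
      funext fun i => (G i).eq_fst s ht]
    rfl

/-- The map `γ_*` on `π_l`: `γ_*([f]; [g₁], …, [g_k]) = [γ(f; g₁, …, g_k)]`. -/
def loopCompQ (f : π_ l (C.obj k) a) (g : ∀ i, π_ l (C.obj (m i)) (b i)) :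
    π_ l (C.obj N) (C.ops.comp m h a b) :=
  Quotient.mk _ (C.loopComp m h (Quotient.out f) (fun i => Quotient.out (g i)))

theorem loopCompQ_mk (f : GenLoop (Fin l) (C.obj k) a)
    (g : ∀ i, GenLoop (Fin l) (C.obj (m i)) (b i)) :
    C.loopCompQ (l := l) m h (Quotient.mk _ f) (fun i => Quotient.mk _ (g i)) =
      Quotient.mk _ (C.loopComp m h f g) :=
  Quotient.sound (C.loopComp_homotopic m h (Quotient.mk_out f) (fun i => Quotient.mk_out (g i)))

end TopOperad

/-! ### The homotopy groups operads -/

namespace GoodBasepoint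

variable {C : TopOperad.{u}} (E : GoodBasepoint C)

/-- `π₁C = {π₁(C(k), e_k)}`. -/
abbrev pi1 (k : ℕ) : Type u := Pi1 (C.obj k) (E.e k)

/-- `π_l C = {π_l(C(k), e_k)}`. -/
abbrev pil (l k : ℕ) : Type u := π_ l (C.obj k) (E.e k)

/-- The operad operations of `π₁C`: `γ([f]; [g₁], …) = [δ] [γ(f; g₁, …)] [δ]⁻¹`. -/
def pi1Ops : OperadOps E.pi1 where
  comp m _ h f g := ((Path.Homotopic.Quotient.mk (E.δ m h)).trans (C.pathCompQ m h f g)).trans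
    (Path.Homotopic.Quotient.mk (E.δ m h)).symm
  one := 1

/-- The operad operations of `π_l C`: `γ = δ_* ∘ γ_*`; the unit is the class of the constant map
at `e₁ = 1`. -/
def pilOps (l : ℕ) : OperadOps (E.pil l) where
  comp m _ h f g := transportPi (.mk (E.δ m h)) (C.loopCompQ m h f g)
  one := Quotient.mk _ GenLoop.const

end GoodBasepoint

/-! ### The symmetric case -/

namespace SymmTopOperad

variable (C : SymmTopOperad.{u})

/-- The orbit space `C(k)/S_k`. -/
abbrev orbitSpace (k : ℕ) : Type u := MulAction.orbitRel.Quotient (SG k) (C.obj k)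

/-- The quotient map `C(k) → C(k)/S_k`. -/
def quot (k : ℕ) : C(C.obj k, C.orbitSpace k) :=
  ⟨Quotient.mk (MulAction.orbitRel (SG k) (C.obj k)), continuous_quot_mk⟩

theorem quot_smul {k : ℕ} (σ : SG k) (x : C.obj k) : C.quot k (σ • x) = C.quot k x :=
  Quotient.sound ⟨σ, rfl⟩

variable (E : GoodBasepoint C.toTopOperad)

/-- `π₁(C/𝒮) = {π₁(C(k)/S_k, S_k e_k)}`. -/
abbrev pi1 (k : ℕ) : Type u := Pi1 (C.orbitSpace k) (C.quot k (E.e k))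

/-- `π_l(C/𝒮) = {π_l(C(k)/S_k, S_k e_k)}`. -/
abbrev pil (l k : ℕ) : Type u := π_ l (C.orbitSpace k) (C.quot k (E.e k))

/-- `π₁(C(k); e_k, S_k e_k)`: homotopy classes relative to the endpoints of paths in `C(k)` from
`e_k` to a point `σ e_k` of its orbit, recorded together with `σ`. -/
abbrev liftedPi1 (k : ℕ) : Type u := Σ σ : SG k, Path.Homotopic.Quotient (E.e k) (σ • E.e k)

/-- The natural map `π₁(C(k); e_k, S_k e_k) → π₁(C(k)/S_k, S_k e_k)`. -/
def projPi1 (k : ℕ) (x : C.liftedPi1 E k) : C.pi1 E k :=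
  (x.2.map (C.quot k)).cast rfl (C.quot_smul x.1 (E.e k)).symm

/-- The operad operations of `{π₁(C(k); e_k, S_k e_k)}`: `γ([f]; [g₁], …)` is the class of the path
`δ₁ · γ(f; g₁, …) · γ(σ; τ₁, …)δ₂⁻¹` from `e_N` to `γ(σ; τ₁, …) e_N`, where `f` ends at `σ e_k`,
`gᵢ` ends at `τᵢ e_{mᵢ}`, and `δ₂` is the linear path from `e_N` to
`γ(e_k; e_{m_{σ⁻¹(1)}}, …, e_{m_{σ⁻¹(k)}})`. -/
def liftedPi1Ops : OperadOps (C.liftedPi1 E) where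
  comp {k} m {N} h x y :=
    ⟨symOps.comp m h x.1 (fun i => (y i).1),
      ((Path.Homotopic.Quotient.mk (E.δ m h)).trans
        (C.pathCompQ m h x.2 (fun i => (y i).2))).trans
        (((Path.Homotopic.Quotient.mk
            (E.δ (fun i => m (x.1.unop.symm i)) (sum_perm_eq h x.1.unop))).symm.map
          ⟨fun z : C.obj N => symOps.comp m h x.1 (fun i => (y i).1) • z,
            continuous_const_smul _⟩).cast
          (C.isGOperad.equivariant m h x.1 (fun i => (y i).1) (E.e k) (fun i => E.e (m i)))
          rfl)⟩
  one := ⟨1, (Path.Homotopic.Quotient.refl (E.e 1)).cast rfl (one_smul _ _)⟩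

end SymmTopOperad

end

/-! Formed pointwise, γ satisfies every operad identity strictly and commutes with concatenation of
paths, translation by the group and change of basepoint. The only difficulty is the correction by
the paths δ. These are images of paths in (𝒞₁)₀, and ordered tuples of intervals form a convex set,
so two paths in (𝒞₁)₀(k) with the same endpoints are homotopic (`C10.homotopic`). Hence η yields one
canonical class `lin c c'` from η c to η c'. Canonical classes compose, and since η is a morphism of
operads, γ sends families of them to canonical classes (`samePath_pathCompQ_lin`). All corrections
therefore cancel or merge.

Both parts are instances of one construction. Let a group operad (P, π) with groups G_n act on C,
and consider pairs of σ in G_k and a class of paths from e_k to σ e_k, with product (σ, f)(τ, g) =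
(στ, f · σg), acting on π_l(C(k), e_k) by translation followed by change of basepoint. Trivial
groups give loops, hence part (1); the symmetric groups give the sets L_k of part (2). `Represents`
and `RepresentsPi` say that an element arises from an uncorrected path or sphere between points of
the image of η by adding canonical classes. `Represents.comp`, `Represents.mul`, `RepresentsPi.comp`
and `RepresentsPi.act` compute the operations on uncorrected representatives, and `Represents.eq`
and `RepresentsPi.eq` reduce each axiom to identities in the groups, in (𝒞₁)₀ and pointwise in C.

For part (2), covering theory identifies L_k with π₁(C(k)/S_k) and π_l(C(k)) with π_l(C(k)/S_k) for
l > 1, compatibly with products and actions. The group laws on pairs need no separate proof: they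
come from the fundamental group through a multiplicative bijection.

Operad laws identify endpoints and basepoints only propositionally, so identities are proved in the
heterogeneous relations `SamePath` and `SamePi` and turned into equalities at the end. -/

/-! ### Homotopy classes of paths up to equality of endpoints -/

section SamePath

variable {X : Type u} [TopologicalSpace X]

/-- Equality of homotopy classes of paths whose endpoints agree only propositionally. -/
inductive SamePath : ∀ {x y x' y' : X},
    Path.Homotopic.Quotient x y → Path.Homotopic.Quotient x' y' → Prop
  | refl {x y : X} (p : Path.Homotopic.Quotient x y) : SamePath p p

namespace SamePath

variable {x y z x' y' z' x'' y'' : X}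

theorem eq {p q : Path.Homotopic.Quotient x y} (h : SamePath p q) : p = q := by
  cases h; rfl

theorem symm {p : Path.Homotopic.Quotient x y} {q : Path.Homotopic.Quotient x' y'}
    (h : SamePath p q) : SamePath q p := by
  cases h; exact .refl _

theorem trans {p : Path.Homotopic.Quotient x y} {q : Path.Homotopic.Quotient x' y'}
    {r : Path.Homotopic.Quotient x'' y''} (h : SamePath p q) (h' : SamePath q r) :
    SamePath p r := by
  cases h; exact h'

theorem of_eq {p q : Path.Homotopic.Quotient x y} (h : p = q) : SamePath p q := h ▸ .refl _

theorem cast (p : Path.Homotopic.Quotient x y) (hx : x' = x) (hy : y' = y) :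
    SamePath (p.cast hx hy) p := by
  subst hx hy
  rw [Path.Homotopic.Quotient.cast_rfl_rfl]
  exact .refl _

theorem iff_exists_cast {p : Path.Homotopic.Quotient x y} {q : Path.Homotopic.Quotient x' y'} :
    SamePath p q ↔ ∃ (hx : x = x') (hy : y = y'), p = q.cast hx hy := by
  constructor
  · intro h
    cases h
    exact ⟨rfl, rfl, (Path.Homotopic.Quotient.cast_rfl_rfl _).symm⟩
  · rintro ⟨rfl, rfl, rfl⟩
    exact cast _ _ _

theorem comp {p : Path.Homotopic.Quotient x y} {q : Path.Homotopic.Quotient y z}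
    {p' : Path.Homotopic.Quotient x' y'} {q' : Path.Homotopic.Quotient y' z'}
    (h : SamePath p p') (h' : SamePath q q') : SamePath (p.trans q) (p'.trans q') := by
  obtain ⟨rfl, rfl, rfl⟩ := iff_exists_cast.1 h
  obtain ⟨_, rfl, rfl⟩ := iff_exists_cast.1 h'
  simp only [Path.Homotopic.Quotient.cast_rfl_rfl]
  exact .refl _

theorem inv {p : Path.Homotopic.Quotient x y} {p' : Path.Homotopic.Quotient x' y'}
    (h : SamePath p p') : SamePath p.symm p'.symm := by
  cases h; exact .refl _

theorem map {Y : Type v} [TopologicalSpace Y] {p : Path.Homotopic.Quotient x y}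
    {p' : Path.Homotopic.Quotient x' y'} (h : SamePath p p') (f : C(X, Y)) :
    SamePath (p.map f) (p'.map f) := by
  cases h; exact .refl _

/-- The pointwise laws of C enter the path calculus here: agreement at the parameters 0 and 1
already forces the endpoints to agree. -/
theorem mk {p : Path x y} {q : Path x' y'} (h : ∀ t, p t = q t) :
    SamePath (Path.Homotopic.Quotient.mk p) (Path.Homotopic.Quotient.mk q) := by
  obtain rfl : x = x' := by simpa using h 0
  obtain rfl : y = y' := by simpa using h 1
  exact of_eq (congrArg _ (Path.ext (funext h)))

theorem map_id (p : Path.Homotopic.Quotient x y) (f : C(X, X)) (hf : ∀ z, f z = z) :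
    SamePath (p.map f) p := by
  obtain ⟨p, rfl⟩ := Path.Homotopic.Quotient.mk_surjective p
  exact mk fun t => hf _

end SamePath

theorem Path.Homotopic.Quotient.map_trans {Y : Type v} [TopologicalSpace Y] {x y z : X}
    (p : Path.Homotopic.Quotient x y) (q : Path.Homotopic.Quotient y z) (f : C(X, Y)) :
    (p.trans q).map f = (p.map f).trans (q.map f) := by
  obtain ⟨p, rfl⟩ := Path.Homotopic.Quotient.mk_surjective p
  obtain ⟨q, rfl⟩ := Path.Homotopic.Quotient.mk_surjective q
  exact congrArg Path.Homotopic.Quotient.mk (p.map_trans q f.continuous)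

theorem exists_paths_mk {ι : Type*} {Y : ι → Type*} [∀ i, TopologicalSpace (Y i)]
    {b b' : ∀ i, Y i} (g : ∀ i, Path.Homotopic.Quotient (b i) (b' i)) :
    ∃ g' : ∀ i, Path (b i) (b' i), g = fun i => .mk (g' i) := by
  choose g' hg' using fun i => Path.Homotopic.Quotient.mk_surjective (g i)
  exact ⟨g', funext fun i => (hg' i).symm⟩

end SamePath

/-! ### The change of basepoint on homotopy groups -/

section FreeHomotopy

variable {X : Type u} [TopologicalSpace X] {l : ℕ} {x y z : X}

/-- `f` and `g` are homotopic through maps that send the boundary of the cube to the points of the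
path `p`. -/
def FreelyHomotopic (p : Path x y) (f : GenLoop (Fin l) X x) (g : GenLoop (Fin l) X y) : Prop :=
  ∃ H : ContinuousMap.Homotopy f.1 g.1, ∀ s, ∀ t ∈ Cube.boundary (Fin l), H (s, t) = p s

theorem FreelyHomotopic.trans {p : Path x y} {q : Path y z} {f : GenLoop (Fin l) X x}
    {g : GenLoop (Fin l) X y} {k : GenLoop (Fin l) X z} (h : FreelyHomotopic p f g)
    (h' : FreelyHomotopic q g k) : FreelyHomotopic (p.trans q) f k := by
  obtain ⟨H, hH⟩ := h
  obtain ⟨H', hH'⟩ := h'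
  refine ⟨H.trans H', fun s t ht => ?_⟩
  rw [ContinuousMap.Homotopy.trans_apply, Path.trans_apply]
  dsimp only
  split_ifs
  · exact hH _ t ht
  · exact hH' _ t ht

theorem FreelyHomotopic.homotopic {f g : GenLoop (Fin l) X x}
    (h : FreelyHomotopic (Path.refl x) f g) : GenLoop.Homotopic f g := by
  obtain ⟨H, hH⟩ := h
  exact ⟨⟨H, fun s t ht => (hH s t ht).trans (f.2 t ht).symm⟩⟩

theorem cubeRad_le_one (t : Fin l → unitInterval) : cubeRad t ≤ 1 := by
  refine (pi_norm_le_iff_of_nonneg zero_le_one).2 fun i => ?_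
  rw [Real.norm_eq_abs, abs_le]
  have h0 := (t i).2.1
  have h1 := (t i).2.2
  constructor <;> linarith

/-- The map stretching the concentric cube of radius `1 / r` onto the cube. -/
noncomputable def cubeStretch (r : ℝ) (t : Fin l → unitInterval) : Fin l → unitInterval := fun i =>
  Set.projIcc (0 : ℝ) 1 zero_le_one (r * ((t i : ℝ) - 1 / 2) + 1 / 2)

/-- If no coordinate of the stretched point is 0 or 1, then none was clamped, and t lies strictly
inside the concentric cube of radius 1 / r. This is the gluing condition in `freelyHomotopic_shell`.
-/
theorem cubeStretch_of_rad_eq {r : ℝ} (hr : 0 < r) {t : Fin l → unitInterval}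
    (h : r * cubeRad t = 1) : cubeStretch r t ∈ Cube.boundary (Fin l) := by
  by_contra hcon
  have hlt : cubeRad t < 1 / r := by
    refine (pi_norm_lt_iff (by positivity)).2 fun i => ?_
    rw [Real.norm_eq_abs, abs_lt, ← neg_div, div_lt_iff₀ hr, lt_div_iff₀ hr]
    have h0 : cubeStretch r t i ≠ 0 := fun h0 => hcon ⟨i, Or.inl h0⟩
    have h1 : cubeStretch r t i ≠ 1 := fun h1 => hcon ⟨i, Or.inr h1⟩
    constructor
    · by_contra hle
      exact h0 (Set.projIcc_of_le_left _ (by nlinarith))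
    · by_contra hle
      exact h1 (Set.projIcc_of_right_le _ (by nlinarith))
  rw [lt_div_iff₀ hr] at hlt
  linarith

theorem cubeStretch_one (t : Fin l → unitInterval) : cubeStretch 1 t = t := by
  funext i
  simp only [cubeStretch, one_mul, sub_add_cancel]
  exact Set.projIcc_val _ _

theorem cubeStretch_two (t : Fin l → unitInterval) : cubeStretch 2 t = cubeInner t := by
  funext i
  simp only [cubeStretch, cubeInner]
  congr 1
  ring

/-- The inner cube grows: at time s it has radius 1 / (2 - s) and carries g, while the shell around
it carries the part of p from time s to time 1. On the boundary the radius is 1, which gives the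
value p s. -/
theorem freelyHomotopic_shell (p : Path x y) (g : GenLoop (Fin l) X y) :
    FreelyHomotopic p (shell p g) g := by
  have hcont : Continuous fun a : unitInterval × (Fin l → unitInterval) =>
      if (2 - (a.1 : ℝ)) * cubeRad a.2 ≤ 1 then g (cubeStretch (2 - (a.1 : ℝ)) a.2)
      else p (Set.projIcc (0 : ℝ) 1 zero_le_one (2 - (2 - (a.1 : ℝ)) * cubeRad a.2)) := by
    have hr : Continuous fun a : unitInterval × (Fin l → unitInterval) =>
        (2 - (a.1 : ℝ)) * cubeRad a.2 :=
      (continuous_const.sub (continuous_subtype_val.comp continuous_fst)).mul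
        (continuous_cubeRad.comp continuous_snd)
    refine Continuous.if_le ?_ ?_ hr continuous_const ?_
    · refine g.1.continuous.comp (continuous_pi fun i => continuous_projIcc.comp ?_)
      fun_prop
    · exact p.continuous.comp (continuous_projIcc.comp (continuous_const.sub hr))
    · intro a ha
      have h1 := a.1.2.2
      rw [show g (cubeStretch (2 - (a.1 : ℝ)) a.2) = y from
        g.2 _ (cubeStretch_of_rad_eq (by linarith) ha), ha,
        Set.projIcc_of_right_le _ (by norm_num)]
      exact p.target.symm
  refine ⟨⟨⟨_, hcont⟩, fun t => ?_, fun t => ?_⟩, fun s t ht => ?_⟩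
  · change (if _ then _ else _) = if _ then _ else _
    simp only [Set.Icc.coe_zero, sub_zero, cubeStretch_two]
    exact if_congr (by constructor <;> intro h <;> linarith) rfl rfl
  · change (if _ then _ else _) = _
    simp only [Set.Icc.coe_one, show (2 : ℝ) - 1 = 1 by norm_num, one_mul, cubeStretch_one]
    exact if_pos (cubeRad_le_one t)
  · change (if _ then _ else _) = _
    have h1 : cubeRad t = 1 := le_antisymm (cubeRad_le_one t) (cubeRad_of_mem_boundary ht)
    have hs := s.2.2
    rw [h1, mul_one]
    split_ifs with h2
    · have h3 : (s : ℝ) = 1 := by linarith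
      obtain rfl : s = 1 := Subtype.ext h3
      rw [p.target]
      refine g.2 _ ?_
      rw [h3, show (2 : ℝ) - 1 = 1 by norm_num, cubeStretch_one]
      exact ht
    · rw [sub_sub_cancel]
      rw [Set.projIcc_val]

/-- At time s, put the stage H_s on the inner cube and the part of p up to time s on the shell, so
the boundary stays at x. With `freelyHomotopic_shell` this characterizes the change of basepoint by
free homotopies. -/
theorem FreelyHomotopic.homotopic_shell {p : Path x y} {f : GenLoop (Fin l) X x}
    {g : GenLoop (Fin l) X y} (h : FreelyHomotopic p f g) : GenLoop.Homotopic f (shell p g) := by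
  obtain ⟨H, hH⟩ := h
  -- The homotopy below starts at f surrounded by a constant shell, so f is first replaced by that
  -- map.
  refine (freelyHomotopic_shell (Path.refl x) f).homotopic.symm.trans ?_
  refine ⟨⟨⟨⟨fun a => if cubeRad a.2 ≤ 1 / 2 then H (a.1, cubeInner a.2)
    else p (a.1 * cubeOuter a.2), ?_⟩, ?_, ?_⟩, ?_⟩⟩
  · refine continuous_shell (fun s u => p (s * u)) (fun s t => H (s, t)) ?_ H.continuous ?_
    · exact p.continuous.comp (continuous_fst.mul continuous_snd)
    · intro s t ht
      rw [mul_one]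
      exact hH s t ht
  · intro t
    change (if _ then _ else _) = if _ then _ else _
    simp only [H.apply_zero, zero_mul, p.source]
    rfl
  · intro t
    change (if _ then _ else _) = if _ then _ else _
    simp only [H.apply_one, one_mul]
    rfl
  · intro s t ht
    have h1 := cubeRad_of_mem_boundary ht
    change (if _ then _ else _) = (shell (Path.refl x) f) t
    rw [show (shell (Path.refl x) f) t = x from (shell (Path.refl x) f).2 t ht]
    dsimp only
    rw [if_neg (by linarith), cubeOuter_of_mem_boundary ht, mul_zero, p.source]

theorem exists_genLoop_mk (f : π_ l X x) :
    ∃ f' : GenLoop (Fin l) X x, (Quotient.mk _ f' : π_ l X x) = f :=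
  Quotient.exists_rep f

theorem transportPi_mk (p : Path x y) (f : GenLoop (Fin l) X y) :
    transportPi (.mk p) (Quotient.mk _ f : π_ l X y) = Quotient.mk _ (shell p f) := rfl

theorem transportPi_refl (f : π_ l X x) : transportPi (.refl x) f = f := by
  obtain ⟨f, rfl⟩ := exists_genLoop_mk f
  exact Quotient.sound (freelyHomotopic_shell (Path.refl x) f).homotopic

/-- Undoing the two shells one after the other is a free homotopy along the concatenated path, and
such a homotopy determines the class. -/
theorem transportPi_trans (p : Path.Homotopic.Quotient x y) (q : Path.Homotopic.Quotient y z)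
    (f : π_ l X z) : transportPi (p.trans q) f = transportPi p (transportPi q f) := by
  obtain ⟨f, rfl⟩ := exists_genLoop_mk f
  obtain ⟨p, rfl⟩ := Path.Homotopic.Quotient.mk_surjective p
  obtain ⟨q, rfl⟩ := Path.Homotopic.Quotient.mk_surjective q
  exact Quotient.sound ((freelyHomotopic_shell p (shell q f)).trans
    (freelyHomotopic_shell q f)).homotopic_shell.symm

/-- True on representatives: a map applied to a shell is the shell of the images. -/
theorem piMap_transportPi {Y : Type v} [TopologicalSpace Y] (g : C(X, Y))
    (p : Path.Homotopic.Quotient x y) (f : π_ l X y) :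
    piMap g x (transportPi p f) = transportPi (p.map g) (piMap g y f) := by
  obtain ⟨f, rfl⟩ := exists_genLoop_mk f
  obtain ⟨p, rfl⟩ := Path.Homotopic.Quotient.mk_surjective p
  refine congrArg (Quotient.mk _) (GenLoop.ext _ _ fun t => ?_)
  exact apply_ite g _ _ _

/-! ### Elements of homotopy groups up to equality of basepoints -/

/-- Equality of elements of homotopy groups whose basepoints agree only propositionally. -/
inductive SamePi : ∀ {x x' : X}, π_ l X x → π_ l X x' → Prop
  | refl {x : X} (f : π_ l X x) : SamePi f f

namespace SamePi

variable {x' x'' : X}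

theorem eq {f g : π_ l X x} (h : SamePi f g) : f = g := by
  cases h; rfl

theorem symm {f : π_ l X x} {g : π_ l X x'} (h : SamePi f g) : SamePi g f := by
  cases h; exact .refl _

theorem trans {f : π_ l X x} {g : π_ l X x'} {k : π_ l X x''} (h : SamePi f g)
    (h' : SamePi g k) : SamePi f k := by
  cases h; exact h'

theorem of_eq {f g : π_ l X x} (h : f = g) : SamePi f g := h ▸ .refl _

theorem basepoint_eq {f : π_ l X x} {g : π_ l X x'} (h : SamePi f g) : x = x' := by
  cases h; rfl

theorem mk {f : GenLoop (Fin l) X x} {g : GenLoop (Fin l) X x'} (hx : x = x')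
    (h : ∀ t, f t = g t) : SamePi (l := l) (Quotient.mk _ f) (Quotient.mk _ g) := by
  subst hx
  exact of_eq (congrArg _ (GenLoop.ext _ _ h))

/-- Moves an element to a propositionally equal basepoint without an explicit cast. -/
theorem exists_of_eq (f : π_ l X x) (hx : x = x') : ∃ g : π_ l X x', SamePi f g := by
  subst hx
  exact ⟨f, .refl _⟩

theorem piMap {Y : Type v} [TopologicalSpace Y] {f : π_ l X x} {f' : π_ l X x'}
    (h : SamePi f f') (g : C(X, Y)) : SamePi (piMap g x f) (piMap g x' f') := by
  cases h; exact .refl _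

theorem piMap_id (f : π_ l X x) (g : C(X, X)) (hg : ∀ z, g z = z) : SamePi (_root_.piMap g x f) f := by
  obtain ⟨f, rfl⟩ := exists_genLoop_mk f
  exact mk (hg x) fun t => hg _

theorem transportPi {y y' : X} {p : Path.Homotopic.Quotient x y}
    {p' : Path.Homotopic.Quotient x' y'} {f : π_ l X y} {f' : π_ l X y'}
    (hp : SamePath p p') (hf : SamePi f f') :
    SamePi (_root_.transportPi p f) (_root_.transportPi p' f') := by
  cases hp
  rw [hf.eq]
  exact .refl _

end SamePi

theorem exists_genLoops_mk {ι : Type*} {Y : ι → Type*} [∀ i, TopologicalSpace (Y i)]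
    {b : ∀ i, Y i} (g : ∀ i, π_ l (Y i) (b i)) :
    ∃ g' : ∀ i, GenLoop (Fin l) (Y i) (b i), g = fun i => Quotient.mk _ (g' i) := by
  choose g' hg' using fun i => exists_genLoop_mk (g i)
  exact ⟨g', funext fun i => (hg' i).symm⟩

end FreeHomotopy

/-! ### Associativity of the block bookkeeping -/

/-- The map g composed with an inverse of f is a strictly monotone self-map of a finite chain, hence
onto, hence the identity. -/
theorem eq_of_lt_imp_lt {A : Type*} {M : ℕ} (f g : A → Fin M) (hf : Function.Bijective f)
    (h : ∀ a b, f a < f b → g a < g b) : f = g := by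
  have hinv := Function.surjInv_eq hf.2
  have hmono : StrictMono (g ∘ Function.surjInv hf.2) := fun p q hpq =>
    h _ _ (by rwa [hinv, hinv])
  have hid : g ∘ Function.surjInv hf.2 = id := by
    refine (StrictMono.range_inj hmono strictMono_id).1 ?_
    rw [(Finite.injective_iff_surjective.1 hmono.injective).range_eq, Set.range_id]
  funext a
  rw [← id_eq (f a), ← hid, Function.comp_apply, hf.1 (hinv (f a))]

/-- Both sides enumerate the triples (i, j, l) in lexicographic order, and a finite set has only one
enumeration compatible with a given linear order. No sums of block sizes need to be computed. -/
theorem blk_assoc {k : ℕ} (m : Fin k → ℕ) {N : ℕ} (h : N = ∑ i, m i)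
    (n : Fin N → ℕ) {M : ℕ} (hM : M = ∑ p, n p)
    (s : Fin k → ℕ) (hs : ∀ i, s i = ∑ j, n (blk m h ⟨i, j⟩)) (hM' : M = ∑ i, s i)
    (i : Fin k) (j : Fin (m i)) (l : Fin (n (blk m h ⟨i, j⟩))) :
    blk n hM ⟨blk m h ⟨i, j⟩, l⟩ =
      blk s hM' ⟨i, blk (fun j => n (blk m h ⟨i, j⟩)) (hs i) ⟨j, l⟩⟩ := by
  let f : (Σ i, Σ j, Fin (n (blk m h ⟨i, j⟩))) → Fin M := fun a =>
    blk n hM ⟨blk m h ⟨a.1, a.2.1⟩, a.2.2⟩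
  let g : (Σ i, Σ j, Fin (n (blk m h ⟨i, j⟩))) → Fin M := fun a =>
    blk s hM' ⟨a.1, blk (fun j => n (blk m h ⟨a.1, j⟩)) (hs a.1) a.2⟩
  have hlt : ∀ a b, f a < f b → g a < g b := by
    rintro ⟨i, j, l⟩ ⟨i', j', l'⟩ hab
    simp only [f] at hab
    simp only [g]
    rcases lt_trichotomy i i' with hi | rfl | hi
    · exact blk_lt _ _ hi _ _
    · rw [blk_lt_iff_snd]
      rcases lt_trichotomy j j' with hj | rfl | hj
      · exact blk_lt _ _ hj _ _
      · rw [blk_lt_iff_snd] at hab ⊢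
        exact hab
      · exact absurd hab (blk_lt _ _ ((blk_lt_iff_snd _ _ _ _ _).2 hj) _ _).not_gt
    · exact absurd hab (blk_lt _ _ (blk_lt _ _ hi _ _) _ _).not_gt
  have hf : Function.Bijective f := by
    constructor
    · rintro ⟨i, j, l⟩ ⟨i', j', l'⟩ hab
      have h1 := Sigma.mk.inj_iff.1 ((blk n hM).injective hab)
      obtain ⟨rfl, h3⟩ := Sigma.mk.inj_iff.1 ((blk m h).injective h1.1)
      obtain rfl := eq_of_heq h3
      obtain rfl := eq_of_heq h1.2
      rfl
    · intro q
      obtain ⟨⟨p, l⟩, rfl⟩ := (blk n hM).surjective q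
      obtain ⟨⟨i, j⟩, rfl⟩ := (blk m h).surjective p
      exact ⟨⟨i, j, l⟩, rfl⟩
  exact congrFun (eq_of_lt_imp_lt f g hf hlt) ⟨i, j, l⟩

theorem blk_congr {k N : ℕ} {m m' : Fin k → ℕ} (hm : ∀ i, m i = m' i) (h : N = ∑ i, m i)
    (h' : N = ∑ i, m' i) (i : Fin k) (j : Fin (m i)) :
    blk m h ⟨i, j⟩ = blk m' h' ⟨i, j.cast (hm i)⟩ := by
  obtain rfl : m = m' := funext hm
  rfl

theorem blk_single {n : ℕ} (h : n = ∑ _i : Fin 1, n) (i : Fin 1) (j : Fin n) :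
    blk (fun _ => n) h ⟨i, j⟩ = j := by
  have := finSigmaFinEquiv_apply (n := fun _ : Fin 1 => n) ⟨i, j⟩
  obtain rfl := Subsingleton.elim i 0
  refine Fin.ext (this.trans ?_)
  simp

theorem blk_ones {k : ℕ} (h : k = ∑ _i : Fin k, 1) (i : Fin k) (j : Fin 1) :
    blk (fun _ => 1) h ⟨i, j⟩ = i := by
  have := finSigmaFinEquiv_apply (n := fun _ : Fin k => 1) ⟨i, j⟩
  obtain rfl := Subsingleton.elim j 0
  refine Fin.ext (this.trans ?_)
  simp

/-! ### The symmetric groups operad is a group operad -/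

/-- Inverses give the convenient description of γ: positions in the target, whose blocks have the
permuted sizes, are traced back to the source. Every identity in 𝒮 is checked in this form. -/
theorem symComp_symm_apply {k N : ℕ} (m : Fin k → ℕ) (h : N = ∑ i, m i) (σ : SG k)
    (τ : ∀ i, SG (m i)) (i : Fin k) (j : Fin (m (σ.unop.symm i))) :
    (symComp m h σ τ).unop.symm (blk (fun i => m (σ.unop.symm i)) (sum_perm_eq h σ.unop) ⟨i, j⟩) =
      blk m h ⟨σ.unop.symm i, (τ _).unop.symm j⟩ := by
  rw [Equiv.symm_apply_eq]
  simp only [symComp, MulOpposite.unop_op, Equiv.trans_apply, Equiv.symm_apply_apply]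
  congr 1
  rw [← Equiv.symm_apply_eq]
  simp [Equiv.sigmaCongrLeft']

theorem SG.ext_symm {n : ℕ} {σ τ : SG n} (h : ∀ i, σ.unop.symm i = τ.unop.symm i) : σ = τ :=
  MulOpposite.unop_injective (Equiv.symm_bijective.injective (Equiv.ext h))

/-- A target position has coordinates (i, j, l), and both sides trace it back through a, then b,
then c. What remains is to match the two ways of grouping the permuted blocks by means of
`blk_assoc`. -/
theorem symComp_assoc {k : ℕ} (m : Fin k → ℕ) {N : ℕ} (h : N = ∑ i, m i)
    (n : Fin N → ℕ) {M : ℕ} (hM : M = ∑ p, n p)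
    (s : Fin k → ℕ) (hs : ∀ i, s i = ∑ j, n (blk m h ⟨i, j⟩)) (hM' : M = ∑ i, s i)
    (a : SG k) (b : ∀ i, SG (m i)) (c : ∀ p, SG (n p)) :
    symComp n hM (symComp m h a b) c =
      symComp s hM' a (fun i => symComp (fun j => n (blk m h ⟨i, j⟩)) (hs i) (b i)
        (fun j => c (blk m h ⟨i, j⟩))) := by
  refine SG.ext_symm fun q => ?_
  obtain ⟨⟨p, l⟩, rfl⟩ := (blk _ (sum_perm_eq hM (symComp m h a b).unop)).surjective q
  obtain ⟨⟨i, j⟩, rfl⟩ := (blk _ (sum_perm_eq h a.unop)).surjective p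
  have hn : ∀ i j, n ((symComp m h a b).unop.symm
      (blk (fun i => m (a.unop.symm i)) (sum_perm_eq h a.unop) ⟨i, j⟩)) =
      n (blk m h ⟨a.unop.symm i, (b _).unop.symm j⟩) := fun i j =>
    congrArg n (symComp_symm_apply m h a b i j)
  -- The permutation inside a block only reorders the summands of its total size.
  have hs' : ∀ i, s (a.unop.symm i) = ∑ j, n ((symComp m h a b).unop.symm
      (blk (fun i => m (a.unop.symm i)) (sum_perm_eq h a.unop) ⟨i, j⟩)) := fun i => by
    rw [hs, ← Equiv.sum_comp (b (a.unop.symm i)).unop.symm]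
    exact Finset.sum_congr rfl fun j _ => (hn i j).symm
  rw [symComp_symm_apply]
  rw [blk_assoc _ (sum_perm_eq h a.unop) _ _ (fun i => s (a.unop.symm i)) hs'
    (sum_perm_eq hM' a.unop)]
  rw [blk_congr (hn i) _ (sum_perm_eq (hs (a.unop.symm i)) (b (a.unop.symm i)).unop)]
  have h4 := symComp_symm_apply (fun j => n (blk m h ⟨a.unop.symm i, j⟩)) (hs (a.unop.symm i))
    (b (a.unop.symm i)) (fun j => c (blk m h ⟨a.unop.symm i, j⟩)) j (l.cast (hn i j))
  have h3 := symComp_symm_apply s hM' a (fun i => symComp (fun j => n (blk m h ⟨i, j⟩)) (hs i) (b i)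
    (fun j => c (blk m h ⟨i, j⟩))) i (blk _ (sum_perm_eq (hs _) (b _).unop) ⟨j, l.cast (hn i j)⟩)
  rw [h4] at h3
  refine Eq.trans ?_ h3.symm
  rw [← blk_assoc m h n hM]
  -- The indices agree only propositionally, so l and c are rewritten together, inside a sigma type.
  have h5 : (⟨_, l⟩ : Σ p, Fin (n p)) = ⟨blk m h ⟨_, (b _).unop.symm j⟩, l.cast (hn i j)⟩ :=
    Sigma.ext (symComp_symm_apply m h a b i j) ((Fin.heq_ext_iff (hn i j)).2 rfl)
  exact congrArg (fun z : (Σ p, Fin (n p)) => blk n hM ⟨z.1, (c z.1).unop.symm z.2⟩) h5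

theorem symComp_single {n : ℕ} (h : n = ∑ _i : Fin 1, n) (a : SG n) :
    symComp (fun _ : Fin 1 => n) h 1 (fun _ => a) = a := SG.ext_symm fun q => by
  obtain ⟨⟨i, j⟩, rfl⟩ := (blk _ h).surjective q
  have := symComp_symm_apply (fun _ => n) h 1 (fun _ => a) i j
  rw [blk_single, blk_single] at this
  rw [blk_single]
  exact this

theorem symComp_ones {k : ℕ} (h : k = ∑ _i : Fin k, 1) (a : SG k) :
    symComp (fun _ : Fin k => 1) h a (fun _ => 1) = a := SG.ext_symm fun q => by
  obtain ⟨⟨i, j⟩, rfl⟩ := (blk _ h).surjective q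
  have := symComp_symm_apply (fun _ => 1) h a (fun _ => 1) i j
  rw [blk_ones, blk_ones] at this
  rw [blk_ones]
  exact this

theorem isGroupOperad_symOps : IsGroupOperad symOps (fun _ σ => σ) where
  isOperad :=
    { zero_unique := ⟨⟨⟨1⟩, fun σ => SG.ext_symm fun i => i.elim0⟩⟩
      assoc := symComp_assoc
      one_comp := symComp_single
      comp_one := symComp_ones }
  map_mul := fun _ _ => rfl
  map_unit := rfl
  map_comp := fun _ _ _ _ _ => rfl
  unit_eq := rfl
  crossed := fun {k} m {N} h a a' b b' => SG.ext_symm fun q => by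
    obtain ⟨⟨i, j⟩, rfl⟩ := (blk _ (sum_perm_eq h (a * a').unop)).surjective q
    have h0 := symComp_symm_apply m h (a * a') (fun i => b i * b' i) i j
    refine h0.trans ?_
    have h1 := symComp_symm_apply (fun i => m (a.unop.symm i)) (sum_perm_eq h a.unop) a'
      (fun i => b' (a.unop.symm i)) i j
    have h2 := symComp_symm_apply m h a b (a'.unop.symm i) ((b' _).unop.symm j)
    exact (h2.symm.trans (congrArg (symComp m h a b).unop.symm h1.symm))

/-- Makes the trivial map to 𝒮 a morphism of operads, as the non-crossed case requires. -/
theorem symOps_comp_one {k N : ℕ} (m : Fin k → ℕ) (h : N = ∑ i, m i) :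
    symOps.comp m h 1 (fun _ => 1) = 1 := SG.ext_symm fun q => by
  obtain ⟨⟨i, j⟩, rfl⟩ := (blk _ h).surjective q
  exact symComp_symm_apply m h 1 (fun _ => 1) i j

/-! ### The operad `(𝒞₁)₀` -/

namespace C10

variable {k : ℕ}

theorem ext {c c' : C10 k} (h : ∀ p, c.1.1 p = c'.1.1 p) : c = c' :=
  Subtype.ext (Subtype.ext (funext h))

theorem comp_apply (m : Fin k → ℕ) {N : ℕ} (h : N = ∑ i, m i) (c : C10 k)
    (b : ∀ i, C10 (m i)) (q : Σ i, Fin (m i)) :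
    (ops.comp m h c b).1.1 (blk m h q) =
      ((c.1.1 q.1).1 + ((c.1.1 q.1).2 - (c.1.1 q.1).1) * ((b q.1).1.1 q.2).1,
        (c.1.1 q.1).1 + ((c.1.1 q.1).2 - (c.1.1 q.1).1) * ((b q.1).1.1 q.2).2) := by
  conv_rhs => rw [← (blk m h).symm_apply_apply q]
  rfl

/-- In lexicographic coordinates this is associativity of composition of affine maps. -/
theorem comp_assoc (m : Fin k → ℕ) {N : ℕ} (h : N = ∑ i, m i)
    (n : Fin N → ℕ) {M : ℕ} (hM : M = ∑ p, n p)
    (s : Fin k → ℕ) (hs : ∀ i, s i = ∑ j, n (blk m h ⟨i, j⟩)) (hM' : M = ∑ i, s i)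
    (a : C10 k) (b : ∀ i, C10 (m i)) (c : ∀ p, C10 (n p)) :
    ops.comp n hM (ops.comp m h a b) c =
      ops.comp s hM' a (fun i => ops.comp (fun j => n (blk m h ⟨i, j⟩)) (hs i) (b i)
        (fun j => c (blk m h ⟨i, j⟩))) := by
  refine ext fun q => ?_
  obtain ⟨⟨p, l⟩, rfl⟩ := (blk n hM).surjective q
  obtain ⟨⟨i, j⟩, rfl⟩ := (blk m h).surjective p
  rw [comp_apply, blk_assoc m h n hM s hs hM', comp_apply, comp_apply, comp_apply]
  ext <;> ring

theorem std_one_apply (i : Fin 1) : (std 1).1.1 i = (0, 1) := by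
  obtain rfl := Subsingleton.elim i 0
  simp [std, LittleIntervals.std, LittleIntervals.ofOrdered]

theorem one_comp (h : k = ∑ _i : Fin 1, k) (a : C10 k) :
    ops.comp (fun _ : Fin 1 => k) h (std 1) (fun _ => a) = a := by
  refine ext fun q => ?_
  obtain ⟨⟨i, j⟩, rfl⟩ := (blk _ h).surjective q
  rw [comp_apply, blk_single, std_one_apply]
  ext <;> simp

theorem comp_one (h : k = ∑ _i : Fin k, 1) (a : C10 k) :
    ops.comp (fun _ : Fin k => 1) h a (fun _ => std 1) = a := by
  refine ext fun q => ?_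
  obtain ⟨⟨i, j⟩, rfl⟩ := (blk _ h).surjective q
  rw [comp_apply, blk_ones, std_one_apply]
  ext <;> simp

/-- The composite `γ(c_k; c_{m₁}, …, c_{m_k})`. -/
noncomputable def stdComp (m : Fin k → ℕ) {N : ℕ} (h : N = ∑ i, m i) : C10 N :=
  ops.comp m h (std k) (fun i => std (m i))

theorem stdComp_congr {m m' : Fin k → ℕ} (hm : ∀ i, m i = m' i) {N : ℕ} (h : N = ∑ i, m i)
    (h' : N = ∑ i, m' i) : stdComp m h = stdComp m' h' := by
  obtain rfl : m = m' := funext hm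
  rfl

theorem continuous_linPath : Continuous fun x : C10 k × C10 k × unitInterval =>
    linPath x.1 x.2.1 x.2.2 := by
  refine Continuous.subtype_mk (Continuous.subtype_mk (continuous_pi fun i => ?_) _) _
  have h1 : Continuous fun x : C10 k × C10 k × unitInterval => x.1.1.1 i :=
    (continuous_apply i).comp (continuous_subtype_val.comp
      (continuous_subtype_val.comp continuous_fst))
  have h2 : Continuous fun x : C10 k × C10 k × unitInterval => x.2.1.1.1 i :=
    (continuous_apply i).comp (continuous_subtype_val.comp
      (continuous_subtype_val.comp (continuous_fst.comp continuous_snd)))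
  fun_prop

theorem linPath_self (c : C10 k) (t : unitInterval) : linPath c c t = c := by
  refine ext fun i => ?_
  change ((1 - (t : ℝ)) * (c.1.1 i).1 + t * (c.1.1 i).1,
    (1 - (t : ℝ)) * (c.1.1 i).2 + t * (c.1.1 i).2) = _
  ext <;> ring

/-- `(𝒞₁)₀(k)` is simply connected. -/
theorem homotopic {c c' : C10 k} (p q : Path c c') : p.Homotopic q := by
  refine ⟨⟨⟨⟨fun x => linPath (p x.2) (q x.2) x.1, ?_⟩, fun t => ?_, fun t => ?_⟩, ?_⟩⟩
  · exact continuous_linPath.comp ((p.continuous.comp continuous_snd).prodMk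
      ((q.continuous.comp continuous_snd).prodMk continuous_fst))
  · exact (linPath (p t) (q t)).source
  · exact (linPath (p t) (q t)).target
  · rintro s t (rfl | rfl)
    · change linPath (p 0) (q 0) s = p 0
      rw [p.source, q.source, linPath_self]
    · change linPath (p 1) (q 1) s = p 1
      rw [p.target, q.target, linPath_self]

instance {c c' : C10 k} : Subsingleton (Path.Homotopic.Quotient c c') := ⟨fun p q => by
  obtain ⟨p, rfl⟩ := Path.Homotopic.Quotient.mk_surjective p
  obtain ⟨q, rfl⟩ := Path.Homotopic.Quotient.mk_surjective q
  exact Path.Homotopic.Quotient.eq.2 (homotopic p q)⟩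

/-- The path `γ(p; q₁, …, q_k)`. -/
noncomputable def pathComp (m : Fin k → ℕ) {N : ℕ} (h : N = ∑ i, m i) {c c' : C10 k}
    {d d' : ∀ i, C10 (m i)}
    (p : Path c c') (q : ∀ i, Path (d i) (d' i)) :
    Path (ops.comp m h c d) (ops.comp m h c' d') where
  toFun t := ops.comp m h (p t) (fun i => q i t)
  continuous_toFun := by
    refine Continuous.subtype_mk (Continuous.subtype_mk (continuous_pi fun x => ?_) _) _
    have h1 : Continuous fun t => (p t).1.1 ((blk m h).symm x).1 :=
      (continuous_apply _).comp (continuous_subtype_val.comp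
        (continuous_subtype_val.comp p.continuous))
    have h2 : Continuous fun t => (q ((blk m h).symm x).1 t).1.1 ((blk m h).symm x).2 :=
      (continuous_apply _).comp (continuous_subtype_val.comp
        (continuous_subtype_val.comp (q _).continuous))
    fun_prop
  source' := by simp
  target' := by simp

end C10

/-! ### Composition of classes of paths and spheres in a topological operad -/

namespace TopOperad

variable (C : TopOperad.{u}) {k : ℕ} (m : Fin k → ℕ) {N : ℕ} (h : N = ∑ i, m i)
  {a a' a'' : C.obj k} {b b' b'' : ∀ i, C.obj (m i)} {l : ℕ}

/-- Holds on representatives: all the concatenations switch at the same parameter. -/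
theorem pathCompQ_trans (p : Path.Homotopic.Quotient a a') (p' : Path.Homotopic.Quotient a' a'')
    (q : ∀ i, Path.Homotopic.Quotient (b i) (b' i))
    (q' : ∀ i, Path.Homotopic.Quotient (b' i) (b'' i)) :
    C.pathCompQ m h (p.trans p') (fun i => (q i).trans (q' i)) =
      (C.pathCompQ m h p q).trans (C.pathCompQ m h p' q') := by
  obtain ⟨p, rfl⟩ := Path.Homotopic.Quotient.mk_surjective p
  obtain ⟨p', rfl⟩ := Path.Homotopic.Quotient.mk_surjective p'
  obtain ⟨q, rfl⟩ := exists_paths_mk q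
  obtain ⟨q', rfl⟩ := exists_paths_mk q'
  simp only [← Path.Homotopic.Quotient.mk_trans, C.pathCompQ_mk]
  congr 1
  ext t
  simp only [pathComp, Path.trans_apply, Path.coe_mk_mk]
  split_ifs <;> rfl

variable {C} in
theorem samePath_pathCompQ {c c' : C.obj k} {d d' : ∀ i, C.obj (m i)}
    {p : Path.Homotopic.Quotient a a'} {p' : Path.Homotopic.Quotient c c'}
    {q : ∀ i, Path.Homotopic.Quotient (b i) (b' i)}
    {q' : ∀ i, Path.Homotopic.Quotient (d i) (d' i)}
    (hp : SamePath p p') (hq : ∀ i, SamePath (q i) (q' i)) :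
    SamePath (C.pathCompQ m h p q) (C.pathCompQ m h p' q') := by
  cases hp
  obtain rfl : b = d := funext fun i => (SamePath.iff_exists_cast.1 (hq i)).1
  obtain rfl : b' = d' := funext fun i => (SamePath.iff_exists_cast.1 (hq i)).2.1
  obtain rfl : q = q' := funext fun i => (hq i).eq
  exact .refl _

/-- Holds on representatives: whether a point lies in the inner cube or in the shell does not depend
on the path or the sphere. -/
theorem loopCompQ_transportPi (p : Path.Homotopic.Quotient a a')
    (q : ∀ i, Path.Homotopic.Quotient (b i) (b' i)) (f : π_ l (C.obj k) a')
    (g : ∀ i, π_ l (C.obj (m i)) (b' i)) :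
    C.loopCompQ m h (transportPi p f) (fun i => transportPi (q i) (g i)) =
      transportPi (C.pathCompQ m h p q) (C.loopCompQ m h f g) := by
  obtain ⟨p, rfl⟩ := Path.Homotopic.Quotient.mk_surjective p
  obtain ⟨q, rfl⟩ := exists_paths_mk q
  obtain ⟨f, rfl⟩ := exists_genLoop_mk f
  obtain ⟨g, rfl⟩ := exists_genLoops_mk g
  simp only [transportPi_mk, C.pathCompQ_mk, C.loopCompQ_mk]
  refine congrArg (Quotient.mk _) (GenLoop.ext _ _ fun t => ?_)
  change C.ops.comp m h (if cubeRad t ≤ 1 / 2 then _ else _)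
    (fun i => if cubeRad t ≤ 1 / 2 then _ else _) =
    if cubeRad t ≤ 1 / 2 then C.ops.comp m h _ _ else C.ops.comp m h _ _
  split_ifs <;> rfl

variable {C} in
theorem samePi_loopCompQ {c : C.obj k} {d : ∀ i, C.obj (m i)}
    {f : π_ l (C.obj k) a} {f' : π_ l (C.obj k) c}
    {g : ∀ i, π_ l (C.obj (m i)) (b i)} {g' : ∀ i, π_ l (C.obj (m i)) (d i)}
    (hf : SamePi f f') (hg : ∀ i, SamePi (g i) (g' i)) :
    SamePi (C.loopCompQ m h f g) (C.loopCompQ m h f' g') := by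
  cases hf
  obtain rfl : b = d := funext fun i => (hg i).basepoint_eq
  obtain rfl : g = g' := funext fun i => (hg i).eq
  exact .refl _

theorem samePath_assoc (n : Fin N → ℕ) {M : ℕ} (hM : M = ∑ p, n p)
    (s : Fin k → ℕ) (hs : ∀ i, s i = ∑ j, n (blk m h ⟨i, j⟩)) (hM' : M = ∑ i, s i)
    {c c' : ∀ p, C.obj (n p)} (p : Path.Homotopic.Quotient a a')
    (q : ∀ i, Path.Homotopic.Quotient (b i) (b' i))
    (r : ∀ j, Path.Homotopic.Quotient (c j) (c' j)) :
    SamePath (C.pathCompQ n hM (C.pathCompQ m h p q) r)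
      (C.pathCompQ s hM' p (fun i => C.pathCompQ (fun j => n (blk m h ⟨i, j⟩)) (hs i) (q i)
        (fun j => r (blk m h ⟨i, j⟩)))) := by
  obtain ⟨p, rfl⟩ := Path.Homotopic.Quotient.mk_surjective p
  obtain ⟨q, rfl⟩ := exists_paths_mk q
  obtain ⟨r, rfl⟩ := exists_paths_mk r
  simp only [C.pathCompQ_mk]
  exact .mk fun t => C.isOperad.assoc m h n hM s hs hM' _ _ _

theorem samePi_assoc (n : Fin N → ℕ) {M : ℕ} (hM : M = ∑ p, n p)
    (s : Fin k → ℕ) (hs : ∀ i, s i = ∑ j, n (blk m h ⟨i, j⟩)) (hM' : M = ∑ i, s i)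
    {c : ∀ p, C.obj (n p)} (f : π_ l (C.obj k) a) (g : ∀ i, π_ l (C.obj (m i)) (b i))
    (r : ∀ j, π_ l (C.obj (n j)) (c j)) :
    SamePi (C.loopCompQ n hM (C.loopCompQ m h f g) r)
      (C.loopCompQ s hM' f (fun i => C.loopCompQ (fun j => n (blk m h ⟨i, j⟩)) (hs i) (g i)
        (fun j => r (blk m h ⟨i, j⟩)))) := by
  obtain ⟨f, rfl⟩ := exists_genLoop_mk f
  obtain ⟨g, rfl⟩ := exists_genLoops_mk g
  obtain ⟨r, rfl⟩ := exists_genLoops_mk r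
  simp only [C.loopCompQ_mk]
  exact .mk (C.isOperad.assoc m h n hM s hs hM' _ _ _)
    fun t => C.isOperad.assoc m h n hM s hs hM' _ _ _

theorem samePath_one_comp (h : k = ∑ _i : Fin 1, k) (p : Path.Homotopic.Quotient a a') :
    SamePath (C.pathCompQ (fun _ : Fin 1 => k) h (.refl C.ops.one) (fun _ => p)) p := by
  obtain ⟨p, rfl⟩ := Path.Homotopic.Quotient.mk_surjective p
  rw [← Path.Homotopic.Quotient.mk_refl, C.pathCompQ_mk (fun _ => k) h _ (fun _ => p)]
  exact .mk fun t => C.isOperad.one_comp h _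

theorem samePath_comp_one (h : k = ∑ _i : Fin k, 1) (p : Path.Homotopic.Quotient a a') :
    SamePath (C.pathCompQ (fun _ : Fin k => 1) h p (fun _ => .refl C.ops.one)) p := by
  obtain ⟨p, rfl⟩ := Path.Homotopic.Quotient.mk_surjective p
  simp only [← Path.Homotopic.Quotient.mk_refl]
  rw [C.pathCompQ_mk (fun _ => 1) h p (fun _ => Path.refl _)]
  exact .mk fun t => C.isOperad.comp_one h _

theorem samePi_one_comp (h : k = ∑ _i : Fin 1, k) (f : π_ l (C.obj k) a) :
    SamePi (C.loopCompQ (fun _ : Fin 1 => k) h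
      (Quotient.mk _ (GenLoop.const : GenLoop (Fin l) _ C.ops.one)) (fun _ => f)) f := by
  obtain ⟨f, rfl⟩ := exists_genLoop_mk f
  rw [C.loopCompQ_mk (fun _ => k) h _ (fun _ => f)]
  exact .mk (C.isOperad.one_comp h _) fun t => C.isOperad.one_comp h _

theorem samePi_comp_one (h : k = ∑ _i : Fin k, 1) (f : π_ l (C.obj k) a) :
    SamePi (C.loopCompQ (fun _ : Fin k => 1) h f
      (fun _ => Quotient.mk _ (GenLoop.const : GenLoop (Fin l) _ C.ops.one))) f := by
  obtain ⟨f, rfl⟩ := exists_genLoop_mk f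
  rw [C.loopCompQ_mk (fun _ => 1) h f (fun _ => GenLoop.const)]
  exact .mk (C.isOperad.comp_one h _) fun t => C.isOperad.comp_one h _

end TopOperad

/-! ### The canonical paths between the points of the image of `(𝒞₁)₀` -/

namespace GoodBasepoint

variable {C : TopOperad.{u}} (E : GoodBasepoint C) {k : ℕ}

/-- The class of the image of the linear path from `c` to `c'`. -/
noncomputable def lin (c c' : C10 k) : Path.Homotopic.Quotient (E.η k c) (E.η k c') :=
  .mk ((C10.linPath c c').map (E.continuous_η k))

/-- Simple connectedness of (𝒞₁)₀(k) enters here. Consequently canonical classes are closed under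
concatenation and reversal. -/
theorem mk_map_eq_lin {c c' : C10 k} (p : Path c c') :
    Path.Homotopic.Quotient.mk (p.map (E.continuous_η k)) = E.lin c c' :=
  Path.Homotopic.Quotient.eq.2 ((C10.homotopic p _).map ⟨_, E.continuous_η k⟩)

theorem lin_trans (c c' c'' : C10 k) : (E.lin c c').trans (E.lin c' c'') = E.lin c c'' := by
  rw [← E.mk_map_eq_lin ((C10.linPath c c').trans (C10.linPath c' c'')), Path.map_trans]
  rfl

theorem lin_self (c : C10 k) : E.lin c c = .refl _ :=
  (E.mk_map_eq_lin (Path.refl c)).symm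

theorem lin_symm (c c' : C10 k) : (E.lin c c').symm = E.lin c' c :=
  E.mk_map_eq_lin (C10.linPath c c').symm

variable (m : Fin k → ℕ) {N : ℕ} (h : N = ∑ i, m i)

theorem samePath_δ :
    SamePath (Path.Homotopic.Quotient.mk (E.δ m h)) (E.lin (C10.std N) (C10.stdComp m h)) :=
  .mk fun _ => rfl

/-- Since η preserves γ, the left side is the image of a path in (𝒞₁)₀, and every such image is
canonical. -/
theorem samePath_pathCompQ_lin (c c' : C10 k) (d d' : ∀ i, C10 (m i)) :
    SamePath (C.pathCompQ m h (E.lin c c') (fun i => E.lin (d i) (d' i)))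
      (E.lin (C10.ops.comp m h c d) (C10.ops.comp m h c' d')) := by
  rw [← E.mk_map_eq_lin (C10.pathComp m h (C10.linPath c c') (fun i => C10.linPath (d i) (d' i)))]
  unfold lin
  rw [C.pathCompQ_mk m h _ (fun i => (C10.linPath (d i) (d' i)).map (E.continuous_η _))]
  exact .mk fun t => (E.map_comp m h _ _).symm

end GoodBasepoint

/-! ### The operad of path classes from the basepoints to points of their orbits -/

theorem OperadOps.IsOperad.transport {C : ℕ → Type u} {D : ℕ → Type v} {O : OperadOps C}
    (hO : O.IsOperad) (e : ∀ n, C n ≃ D n) : (O.transport e).IsOperad where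
  zero_unique := hO.zero_unique.map fun u => @Equiv.unique _ _ u (e 0).symm
  assoc m N h n M hM s hs hM' a b c := by
    simp only [OperadOps.transport, Equiv.symm_apply_apply]
    rw [hO.assoc m h n hM s hs hM']
  one_comp h a := by
    simp only [OperadOps.transport, Equiv.symm_apply_apply]
    rw [hO.one_comp h, Equiv.apply_symm_apply]
  comp_one h a := by
    simp only [OperadOps.transport, Equiv.symm_apply_apply]
    rw [hO.comp_one h, Equiv.apply_symm_apply]

/-! ### Homotopy classes in one-point spaces, for arity zero -/

theorem subsingleton_pathQuotient {X : Type u} [TopologicalSpace X] [Subsingleton X] (x y : X) :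
    Subsingleton (Path.Homotopic.Quotient x y) := ⟨fun p q => by
  obtain ⟨p, rfl⟩ := Path.Homotopic.Quotient.mk_surjective p
  obtain ⟨q, rfl⟩ := Path.Homotopic.Quotient.mk_surjective q
  exact congrArg _ (Path.ext (Subsingleton.elim _ _))⟩

theorem subsingleton_pi {X : Type u} [TopologicalSpace X] [Subsingleton X] (l : ℕ) (x : X) :
    Subsingleton (π_ l X x) := ⟨fun f g => by
  obtain ⟨f, rfl⟩ := exists_genLoop_mk f
  obtain ⟨g, rfl⟩ := exists_genLoop_mk g
  exact congrArg _ (GenLoop.ext _ _ fun _ => Subsingleton.elim _ _)⟩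

/-! ### Translation of paths and spheres by a group operad acting on C -/

section Action

variable {C : TopOperad.{u}} {G : ℕ → Type} [∀ n, Group (G n)]
  [∀ n, MulAction (G n) (C.obj n)] [∀ n, ContinuousConstSMul (G n) (C.obj n)]

/-- The action of `σ` as a continuous map. -/
def smulMap {n : ℕ} (σ : G n) : C(C.obj n, C.obj n) := ⟨fun z => σ • z, continuous_const_smul σ⟩

/-- The translate of a class of paths. -/
noncomputable def smulPath {n : ℕ} {x y : C.obj n} (σ : G n) (p : Path.Homotopic.Quotient x y) :
    Path.Homotopic.Quotient (σ • x) (σ • y) := p.map (smulMap σ)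

/-- The translate of an element of a homotopy group. -/
noncomputable def smulPi {n l : ℕ} {x : C.obj n} (σ : G n) (f : π_ l (C.obj n) x) :
    π_ l (C.obj n) (σ • x) := piMap (smulMap σ) x f

theorem SamePath.smul {n : ℕ} {x y x' y' : C.obj n} {p : Path.Homotopic.Quotient x y}
    {p' : Path.Homotopic.Quotient x' y'} (h : SamePath p p') (σ : G n) :
    SamePath (smulPath σ p) (smulPath σ p') := h.map _

theorem SamePi.smul {n l : ℕ} {x x' : C.obj n} {f : π_ l (C.obj n) x} {f' : π_ l (C.obj n) x'}
    (h : SamePi f f') (σ : G n) : SamePi (smulPi σ f) (smulPi σ f') := h.piMap _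

theorem smulPath_trans {n : ℕ} {x y z : C.obj n} (σ : G n) (p : Path.Homotopic.Quotient x y)
    (q : Path.Homotopic.Quotient y z) :
    smulPath σ (p.trans q) = (smulPath σ p).trans (smulPath σ q) :=
  Path.Homotopic.Quotient.map_trans p q _

theorem smulPath_refl {n : ℕ} (σ : G n) (x : C.obj n) :
    smulPath σ (Path.Homotopic.Quotient.refl x) = .refl (σ • x) := rfl

theorem samePath_smulPath_mul {n : ℕ} {x y : C.obj n} (σ τ : G n)
    (p : Path.Homotopic.Quotient x y) :
    SamePath (smulPath σ (smulPath τ p)) (smulPath (σ * τ) p) := by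
  obtain ⟨p, rfl⟩ := Path.Homotopic.Quotient.mk_surjective p
  exact .mk fun t => (mul_smul σ τ _).symm

theorem smulPi_transportPi {n l : ℕ} {x y : C.obj n} (σ : G n) (p : Path.Homotopic.Quotient x y)
    (f : π_ l (C.obj n) y) :
    smulPi σ (transportPi p f) = transportPi (smulPath σ p) (smulPi σ f) :=
  piMap_transportPi _ p f

variable {P : OperadOps G} {π : ∀ n, G n → SG n}
  (hC : IsGOperad P π C.ops (fun n (σ : G n) (x : C.obj n) => σ • x))
  {k : ℕ} (m : Fin k → ℕ) {N : ℕ} (h : N = ∑ i, m i) (σ : G k) (τ : ∀ i, G (m i))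
  {a a' : C.obj k} {b b' : ∀ i, C.obj (m i)} {l : ℕ}

-- The equivariance axiom of C applied at each parameter.
include hC in
theorem IsGOperad.samePath_equivariant (p : Path.Homotopic.Quotient a a')
    (q : ∀ i, Path.Homotopic.Quotient (b i) (b' i)) :
    SamePath (C.pathCompQ m h (smulPath σ p) (fun i => smulPath (τ i) (q i)))
      (smulPath (P.comp m h σ τ) (C.pathCompQ (fun i => m ((π k σ).unop.symm i))
        (sum_perm_eq h _) p (fun i => q ((π k σ).unop.symm i)))) := by
  obtain ⟨p, rfl⟩ := Path.Homotopic.Quotient.mk_surjective p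
  obtain ⟨q, rfl⟩ := exists_paths_mk q
  rw [C.pathCompQ_mk _ _ p (fun i => q ((π k σ).unop.symm i))]
  refine (SamePath.of_eq (C.pathCompQ_mk m h _ _)).trans ?_
  exact .mk fun t => hC.equivariant m h σ τ _ _

include hC in
theorem IsGOperad.samePi_equivariant (f : π_ l (C.obj k) a) (g : ∀ i, π_ l (C.obj (m i)) (b i)) :
    SamePi (C.loopCompQ m h (smulPi σ f) (fun i => smulPi (τ i) (g i)))
      (smulPi (P.comp m h σ τ)
        (C.loopCompQ (fun i => m ((π k σ).unop.symm i)) (sum_perm_eq h _) f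
          (fun i => g ((π k σ).unop.symm i)))) := by
  obtain ⟨f, rfl⟩ := exists_genLoop_mk f
  obtain ⟨g, rfl⟩ := exists_genLoops_mk g
  rw [C.loopCompQ_mk _ _ f (fun i => g ((π k σ).unop.symm i))]
  refine (SamePi.of_eq (C.loopCompQ_mk m h _ _)).trans ?_
  exact .mk (hC.equivariant m h σ τ _ _) fun t => hC.equivariant m h σ τ _ _

/-! ### Classes of paths to orbit points and their uncorrected representatives -/

namespace GoodBasepoint

variable (E : GoodBasepoint C)

variable (G) in
/-- Classes of paths from `e_k` to a point `σ e_k`, recorded together with `σ`. -/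
abbrev OrbitPath (k : ℕ) : Type u := Σ σ : G k, Path.Homotopic.Quotient (E.e k) (σ • E.e k)

/-- The operad operations on the classes of paths from `e_k` to a point `σ e_k`. -/
noncomputable def orbitPathOps : OperadOps (E.OrbitPath G) where
  comp {k} m _ h x y :=
    ⟨P.comp m h x.1 (fun i => (y i).1),
      ((Path.Homotopic.Quotient.mk (E.δ m h)).trans
        (C.pathCompQ m h x.2 (fun i => (y i).2))).trans
        ((smulPath (P.comp m h x.1 (fun i => (y i).1)) (Path.Homotopic.Quotient.mk
            (E.δ (fun i => m ((π k x.1).unop.symm i)) (sum_perm_eq h (π k x.1).unop))).symm).cast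
          (hC.equivariant m h x.1 (fun i => (y i).1) (E.e k) (fun i => E.e (m i)))
          rfl)⟩
  one := ⟨1, (Path.Homotopic.Quotient.refl (E.e 1)).cast rfl (one_smul _ _)⟩

/-- The product `(σ, [f]) (τ, [g]) = (σ τ, [f · σ g])`. -/
noncomputable def orbitPathMul {k : ℕ} (x y : E.OrbitPath G k) : E.OrbitPath G k :=
  ⟨x.1 * y.1, x.2.trans ((smulPath x.1 y.2).cast rfl (mul_smul _ _ _))⟩

/-- The action of classes of paths to points of the orbit on the homotopy groups. -/
noncomputable def orbitPathAct {k l : ℕ} (x : E.OrbitPath G k) (f : E.pil l k) : E.pil l k :=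
  transportPi x.2 (smulPi x.1 f)

/-- `x` is the class of the path `q` from `η c` to `σ η c'`, completed by linear paths. -/
def Represents {k : ℕ} (c c' : C10 k) {y y' : C.obj k} (q : Path.Homotopic.Quotient y y')
    (x : E.OrbitPath G k) : Prop :=
  ∃ q₀ : Path.Homotopic.Quotient (E.η k c) (x.1 • E.η k c'), SamePath q₀ q ∧
    SamePath x.2 ((E.lin (C10.std k) c).trans
      (q₀.trans (smulPath x.1 (E.lin c' (C10.std k)))))

/-- `f` is obtained by the change of basepoint along a linear path from an element `φ` of a
homotopy group at `η c`. -/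
def RepresentsPi {k : ℕ} (c : C10 k) {y : C.obj k} (φ : π_ l (C.obj k) y) (f : E.pil l k) : Prop :=
  ∃ φ₀ : π_ l (C.obj k) (E.η k c), SamePi φ₀ φ ∧ f = transportPi (E.lin (C10.std k) c) φ₀

/-- The use is in `Represents.comp`: the two δ's are absorbed into the canonical classes at either
end. -/
theorem lin_trans_smulPath_lin {N : ℕ} (ω : G N) (c₀ c₁ c₂ d₀ d₁ d₂ : C10 N)
    (q : Path.Homotopic.Quotient (E.η N c₂) (ω • E.η N d₀)) :
    ((E.lin c₀ c₁).trans ((E.lin c₁ c₂).trans (q.trans (smulPath ω (E.lin d₀ d₁))))).trans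
      (smulPath ω (E.lin d₁ d₂)) =
      (E.lin c₀ c₂).trans (q.trans (smulPath ω (E.lin d₀ d₂))) := by
  rw [← E.lin_trans d₀ d₁ d₂, ← E.lin_trans c₀ c₁ c₂, smulPath_trans]
  simp only [Path.Homotopic.Quotient.trans_assoc]

/-- The translated canonical classes meeting in the middle are mutually inverse; this is the
cancellation behind `Represents.mul`. -/
theorem trans_smulPath_lin_trans {N : ℕ} (ω : G N) (d₀ d₁ : C10 N) {x y z : C.obj N}
    (p : Path.Homotopic.Quotient x y) (q : Path.Homotopic.Quotient y (ω • E.η N d₀))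
    (r : Path.Homotopic.Quotient (ω • E.η N d₀) z) :
    (p.trans (q.trans (smulPath ω (E.lin d₀ d₁)))).trans ((smulPath ω (E.lin d₁ d₀)).trans r) =
      p.trans (q.trans r) := by
  have := smulPath_trans ω (E.lin d₀ d₁) (E.lin d₁ d₀)
  rw [E.lin_trans, E.lin_self, smulPath_refl] at this
  simp only [Path.Homotopic.Quotient.trans_assoc]
  rw [← Path.Homotopic.Quotient.trans_assoc (smulPath ω (E.lin d₀ d₁)), ← this,
    Path.Homotopic.Quotient.refl_trans]

theorem transportPi_trans_smulPath_lin {N : ℕ} (ω : G N) (c₀ c₁ d₀ d₁ : C10 N)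
    (q : Path.Homotopic.Quotient (E.η N c₁) (ω • E.η N d₀)) (f : π_ l (C.obj N) (ω • E.η N d₀)) :
    transportPi ((E.lin c₀ c₁).trans (q.trans (smulPath ω (E.lin d₀ d₁))))
      (transportPi (smulPath ω (E.lin d₁ d₀)) f) =
      transportPi (E.lin c₀ c₁) (transportPi q f) := by
  have := smulPath_trans ω (E.lin d₀ d₁) (E.lin d₁ d₀)
  rw [E.lin_trans, E.lin_self, smulPath_refl] at this
  rw [transportPi_trans, transportPi_trans, ← transportPi_trans (smulPath ω (E.lin d₀ d₁)),
    ← this, transportPi_refl]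

variable {E}

theorem Represents.self {k : ℕ} (x : E.OrbitPath G k) :
    E.Represents (C10.std k) (C10.std k) x.2 x := by
  refine ⟨x.2, .refl _, .of_eq ?_⟩
  rw [lin_self]
  exact ((Path.Homotopic.Quotient.refl_trans _).trans (Path.Homotopic.Quotient.trans_refl _)).symm

/-- The element is determined by σ, the two points of (𝒞₁)₀ and the uncorrected class, because the
completing classes are canonical. Each of the four hypotheses is a separate, easy check in the
applications. -/
theorem Represents.eq {k : ℕ} {c c' d d' : C10 k} {x y : E.OrbitPath G k} {a a' b b' : C.obj k}
    {p : Path.Homotopic.Quotient a a'} {q : Path.Homotopic.Quotient b b'}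
    (hx : E.Represents c c' p x) (hy : E.Represents d d' q y) (h1 : x.1 = y.1)
    (hc : c = d) (hc' : c' = d') (hpq : SamePath p q) : x = y := by
  subst hc hc'
  obtain ⟨σ, x⟩ := x
  obtain ⟨τ, y⟩ := y
  obtain rfl : σ = τ := h1
  obtain ⟨p₀, hp, hx⟩ := hx
  obtain ⟨q₀, hq, hy⟩ := hy
  obtain rfl := ((hp.trans hpq).trans hq.symm).eq
  exact congrArg (Sigma.mk σ) (hx.trans hy.symm).eq

theorem RepresentsPi.self {k : ℕ} (f : E.pil l k) : E.RepresentsPi (C10.std k) f f :=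
  ⟨f, .refl _, by rw [lin_self]; exact (transportPi_refl _).symm⟩

theorem RepresentsPi.eq {k : ℕ} {c d : C10 k} {f g : E.pil l k} {a b : C.obj k}
    {φ : π_ l (C.obj k) a} {ψ : π_ l (C.obj k) b} (hf : E.RepresentsPi c φ f)
    (hg : E.RepresentsPi d ψ g) (hc : c = d) (h : SamePi φ ψ) : f = g := by
  subst hc
  obtain ⟨φ₀, hφ, rfl⟩ := hf
  obtain ⟨ψ₀, hψ, rfl⟩ := hg
  rw [((hφ.trans h).trans hψ.symm).eq]

/-- Distribute γ over the three factors canonical · q · translated canonical. The outer factors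
become canonical again, the last one after equivariance has extracted the group element and permuted
its arguments, and they then absorb the two δ's. -/
theorem Represents.comp {c c' : C10 k} {d d' : ∀ i, C10 (m i)}
    {p : Path.Homotopic.Quotient a a'} {q : ∀ i, Path.Homotopic.Quotient (b i) (b' i)}
    {x : E.OrbitPath G k} {y : ∀ i, E.OrbitPath G (m i)} (hx : E.Represents c c' p x)
    (hy : ∀ i, E.Represents (d i) (d' i) (q i) (y i)) :
    E.Represents (C10.ops.comp m h c d)
      (C10.ops.comp (fun i => m ((π k x.1).unop.symm i)) (sum_perm_eq h _) c'
        (fun i => d' ((π k x.1).unop.symm i)))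
      (C.pathCompQ m h p q) ((E.orbitPathOps hC).comp m h x y) := by
  obtain ⟨p₀, hp, hx⟩ := hx
  choose q₀ hq hy using hy
  -- The endpoint of the composite path is the translate of a point of the image of η, whose blocks
  -- occur in permuted order.
  have hω := hC.equivariant m h x.1 (fun i => (y i).1) (E.η k c') (fun i => E.η (m i) (d' i))
  rw [← E.map_comp] at hω
  refine ⟨(C.pathCompQ m h p₀ q₀).cast (E.map_comp m h c d) hω.symm,
    (SamePath.cast _ _ _).trans (TopOperad.samePath_pathCompQ m h hp hq), ?_⟩
  have hmid := TopOperad.samePath_pathCompQ m h hx hy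
  rw [C.pathCompQ_trans, C.pathCompQ_trans] at hmid
  have hend := (E.samePath_δ (fun i => m ((π k x.1).unop.symm i))
    (sum_perm_eq h (π k x.1).unop)).inv
  rw [E.lin_symm] at hend
  refine SamePath.trans (SamePath.comp (SamePath.comp (E.samePath_δ m h)
    (hmid.trans (SamePath.comp (E.samePath_pathCompQ_lin m h _ _ _ _)
    (SamePath.comp (SamePath.cast _ (E.map_comp m h c d) hω.symm).symm
      ((hC.samePath_equivariant m h x.1 (fun i => (y i).1) _ _).trans
        ((E.samePath_pathCompQ_lin _ _ _ _ _ _).smul _))))))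
    ((SamePath.cast _ _ _).trans (hend.smul _))) (SamePath.of_eq ?_)
  exact E.lin_trans_smulPath_lin _ _ _ _ _ _ _ _

theorem Represents.one :
    E.Represents (C10.std 1) (C10.std 1) (Path.Homotopic.Quotient.refl C.ops.one)
      (E.orbitPathOps hC).one := by
  obtain ⟨q₀, h0, h⟩ := Represents.self (E.orbitPathOps hC).one
  refine ⟨q₀, h0.trans ?_, h⟩
  have hc := SamePath.cast (Path.Homotopic.Quotient.refl (E.e 1)) rfl (one_smul (G 1) (E.e 1))
  refine SamePath.trans hc ?_
  -- The point e₁ is η applied to the unit of (𝒞₁)₀, by definition.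
  change SamePath (Path.Homotopic.Quotient.refl (E.η 1 C10.ops.one)) _
  rw [E.map_one]
  exact .refl _

/-- The first factor ends with a canonical class to the translate of e_k and the second starts by
going back, so the two cancel. The class r stands for the translate of q with endpoints that make it
composable with p. -/
theorem Represents.mul {c c' c'' : C10 k} {x x' : E.OrbitPath G k} {a₀ a₁ b₀ b₁ : C.obj k}
    {p : Path.Homotopic.Quotient a₀ a₁} {q : Path.Homotopic.Quotient b₀ b₁}
    {a₂ : C.obj k} {r : Path.Homotopic.Quotient a₁ a₂}
    (hx : E.Represents c c' p x) (hx' : E.Represents c' c'' q x')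
    (hr : SamePath r (smulPath x.1 q)) :
    E.Represents c c'' (p.trans r) (E.orbitPathMul x x') := by
  obtain ⟨p₀, hp, hx⟩ := hx
  obtain ⟨q₀, hq, hx'⟩ := hx'
  have hx'' := (SamePath.cast (smulPath x.1 x'.2) rfl (mul_smul _ _ _)).trans (hx'.smul x.1)
  rw [smulPath_trans, smulPath_trans] at hx''
  refine ⟨p₀.trans ((smulPath x.1 q₀).cast rfl (mul_smul _ _ _)), SamePath.comp hp
    ((SamePath.cast _ _ _).trans ((hq.smul _).trans hr.symm)), ?_⟩
  refine (SamePath.comp hx hx'').trans ((SamePath.of_eq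
    (E.trans_smulPath_lin_trans x.1 c' (C10.std k) _ _ _)).trans ?_)
  refine SamePath.comp (.refl _) ?_
  rw [Path.Homotopic.Quotient.trans_assoc]
  exact SamePath.comp (.refl _) (SamePath.comp (SamePath.cast _ _ _).symm
    (samePath_smulPath_mul _ _ _))

/-- The change of basepoint passes through γ, and the resulting canonical class merges with δ. -/
theorem RepresentsPi.comp {c : C10 k} {d : ∀ i, C10 (m i)} {φ : π_ l (C.obj k) a}
    {ψ : ∀ i, π_ l (C.obj (m i)) (b i)} {f : E.pil l k} {g : ∀ i, E.pil l (m i)}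
    (hf : E.RepresentsPi c φ f) (hg : ∀ i, E.RepresentsPi (d i) (ψ i) (g i)) :
    E.RepresentsPi (C10.ops.comp m h c d) (C.loopCompQ m h φ ψ) ((E.pilOps l).comp m h f g) := by
  obtain ⟨φ₀, hφ, rfl⟩ := hf
  choose ψ₀ hψ hg using hg
  obtain rfl : g = _ := funext hg
  obtain ⟨θ, hθ⟩ := SamePi.exists_of_eq (C.loopCompQ m h φ₀ ψ₀) (E.map_comp m h c d).symm
  refine ⟨θ, hθ.symm.trans (TopOperad.samePi_loopCompQ m h hφ hψ), SamePi.eq ?_⟩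
  rw [← E.lin_trans _ (C10.stdComp m h), transportPi_trans]
  change SamePi (transportPi (.mk (E.δ m h)) (C.loopCompQ m h _ _)) _
  refine .transportPi (E.samePath_δ m h) ?_
  refine (SamePi.of_eq (C.loopCompQ_transportPi m h _ _ _ _)).trans ?_
  exact .transportPi (E.samePath_pathCompQ_lin m h _ _ _ _) hθ

theorem RepresentsPi.one :
    E.RepresentsPi (C10.std 1)
      (Quotient.mk _ (GenLoop.const : GenLoop (Fin l) _ C.ops.one)) (E.pilOps l).one := by
  obtain ⟨φ₀, h0, h⟩ := RepresentsPi.self (E.pilOps l).one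
  exact ⟨φ₀, h0.trans (.mk E.map_one fun _ => E.map_one), h⟩

/-- The change of basepoint hidden in f, translated by the group element, cancels the last canonical
class in the path of x. -/
theorem RepresentsPi.act {c c' : C10 k} {x : E.OrbitPath G k} {f : E.pil l k}
    {a₀ a₁ b₀ : C.obj k} {p : Path.Homotopic.Quotient a₀ a₁} {φ : π_ l (C.obj k) b₀}
    {θ : π_ l (C.obj k) a₁} (hx : E.Represents c c' p x) (hf : E.RepresentsPi c' φ f)
    (hθ : SamePi θ (smulPi x.1 φ)) :
    E.RepresentsPi c (transportPi p θ) (E.orbitPathAct x f) := by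
  obtain ⟨p₀, hp, hx⟩ := hx
  obtain ⟨φ₀, hφ, rfl⟩ := hf
  refine ⟨transportPi p₀ (smulPi x.1 φ₀), .transportPi hp ((hφ.smul _).trans hθ.symm),
    SamePi.eq ?_⟩
  refine (SamePi.transportPi hx (.of_eq (smulPi_transportPi _ _ _))).trans (.of_eq ?_)
  exact E.transportPi_trans_smulPath_lin x.1 (C10.std k) c c' (C10.std k) p₀ (smulPi x.1 φ₀)

/-! ### The group operad and its action on the homotopy groups -/

variable (hP : IsGroupOperad P π)

include hP in
theorem symm_comp_apply (i : Fin k) (j : Fin (m ((π k σ).unop.symm i))) :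
    (π N (P.comp m h σ τ)).unop.symm
      (blk (fun i => m ((π k σ).unop.symm i)) (sum_perm_eq h _) ⟨i, j⟩) =
      blk m h ⟨(π k σ).unop.symm i, (π _ (τ _)).unop.symm j⟩ := by
  rw [hP.map_comp]
  exact symComp_symm_apply m h (π k σ) (fun i => π (m i) (τ i)) i j

-- Compares the right endpoints of the two sides of associativity: associativity in (𝒞₁)₀ applies
-- once the block sizes, permuted in two ways, are identified by `symm_comp_apply`.
include hP in
theorem stdComp_comp_std (n : Fin N → ℕ) {M : ℕ} (hM : M = ∑ p, n p)
    (s : Fin k → ℕ) (hs : ∀ i, s i = ∑ j, n (blk m h ⟨i, j⟩)) (hM' : M = ∑ i, s i) :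
    C10.ops.comp (fun p => n ((π N (P.comp m h σ τ)).unop.symm p)) (sum_perm_eq hM _)
        (C10.stdComp (fun i => m ((π k σ).unop.symm i)) (sum_perm_eq h _))
        (fun p => C10.std (n ((π N (P.comp m h σ τ)).unop.symm p))) =
      C10.ops.comp (fun i => s ((π k σ).unop.symm i)) (sum_perm_eq hM' _) (C10.std k)
        (fun i => C10.stdComp (fun j => n (blk m h ⟨(π k σ).unop.symm i,
          (π _ (τ ((π k σ).unop.symm i))).unop.symm j⟩)) (sum_perm_eq (hs _) _)) := by
  have hn := fun i j => congrArg n (symm_comp_apply m h σ τ hP i j)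
  have hs' : ∀ i, s ((π k σ).unop.symm i) = ∑ j, n ((π N (P.comp m h σ τ)).unop.symm
      (blk (fun i => m ((π k σ).unop.symm i)) (sum_perm_eq h _) ⟨i, j⟩)) := fun i => by
    rw [hs, ← Equiv.sum_comp (π _ (τ ((π k σ).unop.symm i))).unop.symm]
    exact Finset.sum_congr rfl fun j _ => (hn i j).symm
  refine (C10.comp_assoc _ _ _ _ (fun i => s ((π k σ).unop.symm i)) hs'
    (sum_perm_eq hM' _) _ _ _).trans ?_
  exact congrArg (C10.ops.comp _ _ _) (funext fun i => C10.stdComp_congr (hn i) _ _)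

variable (E)

include hP in
theorem isOperad_orbitPathOps : (E.orbitPathOps hC).IsOperad where
  zero_unique := by
    obtain ⟨u⟩ := hP.isOperad.zero_unique
    obtain ⟨v⟩ := C.isOperad.zero_unique
    refine ⟨⟨⟨1, (Path.Homotopic.Quotient.refl (E.e 0)).cast rfl (one_smul _ _)⟩, fun x => ?_⟩⟩
    have := subsingleton_pathQuotient (E.e 0) (x.1 • E.e 0)
    exact (Represents.self x).eq (Represents.self _) (Subsingleton.elim _ _) rfl rfl
      (SamePath.iff_exists_cast.2 ⟨rfl, Subsingleton.elim _ _, Subsingleton.elim _ _⟩)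
  assoc m N h n M hM s hs hM' x y z := by
    refine (Represents.comp hC n hM (.comp hC m h (.self x) fun i => .self (y i))
      fun p => .self (z p)).eq (.comp hC s hM' (.self x) fun i => .comp hC _ (hs i) (.self (y i))
      fun j => .self (z (blk m h ⟨i, j⟩))) ?_ ?_ ?_ ?_
    · exact hP.isOperad.assoc m h n hM s hs hM' _ _ _
    · exact C10.comp_assoc m h n hM s hs hM' _ _ _
    · exact stdComp_comp_std m h x.1 (fun i => (y i).1) hP n hM s hs hM'
    · exact C.samePath_assoc m h n hM s hs hM' _ _ _
  one_comp h x := by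
    refine (Represents.comp hC _ h (.one hC) fun _ => .self x).eq (.self x) ?_ ?_ ?_ ?_
    · have := hP.isOperad.one_comp h x.1
      -- The unit pair is built from the group identity, while the operad axioms of P concern its
      -- operadic unit.
      rw [hP.unit_eq] at this
      exact this
    · exact C10.one_comp h _
    · exact C10.one_comp h _
    · exact C.samePath_one_comp h _
  comp_one h x := by
    refine (Represents.comp hC _ h (.self x) fun _ => .one hC).eq (.self x) ?_ ?_ ?_ ?_
    · have := hP.isOperad.comp_one h x.1
      rw [hP.unit_eq] at this
      exact this
    · exact C10.comp_one h _
    · exact C10.comp_one h _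
    · exact C.samePath_comp_one h _

-- Uncorrected, γ of concatenations is a concatenation of γ's, and equivariance identifies its
-- second half with a translate of the γ with permuted arguments. The group components agree by the
-- crossed law of P.
include hP in
theorem orbitPathOps_crossed (x x' : E.OrbitPath G k) (y y' : ∀ i, E.OrbitPath G (m i)) :
    (E.orbitPathOps hC).comp m h (E.orbitPathMul x x') (fun i => E.orbitPathMul (y i) (y' i)) =
      E.orbitPathMul ((E.orbitPathOps hC).comp m h x y)
        ((E.orbitPathOps hC).comp (fun i => m ((π k x.1).unop.symm i)) (sum_perm_eq h _) x'
          (fun i => y' ((π k x.1).unop.symm i))) := by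
  refine (Represents.comp hC m h (.self _) fun i => .self _).eq
    (.mul (.comp hC m h (.self x) fun i => .self (y i))
      (.comp hC (fun i => m ((π k x.1).unop.symm i)) (sum_perm_eq h _) (.self x')
        fun i => .self (y' ((π k x.1).unop.symm i)))
      (r := C.pathCompQ m h ((smulPath x.1 x'.2).cast rfl (mul_smul _ _ _))
        (fun i => (smulPath (y i).1 (y' i).2).cast rfl (mul_smul _ _ _))) ?_) ?_ rfl ?_ ?_
  · exact (TopOperad.samePath_pathCompQ m h (SamePath.cast _ _ _)
      fun i => SamePath.cast _ _ _).trans (hC.samePath_equivariant m h _ _ _ _)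
  · exact hP.crossed m h x.1 x'.1 (fun i => (y i).1) (fun i => (y' i).1)
  · refine C10.stdComp_congr (fun i => ?_) _ _
    change m ((π k (x.1 * x'.1)).unop.symm i) = _
    rw [hP.map_mul]
    rfl
  · exact .of_eq (C.pathCompQ_trans m h _ _ _ _)

theorem isOperad_pilOps (l : ℕ) : (E.pilOps l).IsOperad where
  zero_unique := by
    obtain ⟨v⟩ := C.isOperad.zero_unique
    have := subsingleton_pi l (E.e 0)
    exact ⟨⟨⟨Quotient.mk _ GenLoop.const⟩, fun x => Subsingleton.elim _ _⟩⟩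
  assoc m N h n M hM s hs hM' x y z :=
    (RepresentsPi.comp n hM (.comp m h (.self x) fun i => .self (y i))
      fun p => .self (z p)).eq (.comp s hM' (.self x) fun i => .comp _ (hs i) (.self (y i))
      fun j => .self (z (blk m h ⟨i, j⟩))) (C10.comp_assoc m h n hM s hs hM' _ _ _)
      (C.samePi_assoc m h n hM s hs hM' _ _ _)
  one_comp h x := (RepresentsPi.comp _ h .one fun _ => .self x).eq (.self x)
    (C10.one_comp h _) (C.samePi_one_comp h _)
  comp_one h x := (RepresentsPi.comp _ h (.self x) fun _ => .one).eq (.self x)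
    (C10.comp_one h _) (C.samePi_comp_one h _)

/-- Equivariance moves the translations out of the pointwise γ, and the changes of basepoint pass
through it strictly. -/
theorem pilOps_equivariant (x : E.OrbitPath G k) (y : ∀ i, E.OrbitPath G (m i))
    (f : E.pil l k) (g : ∀ i, E.pil l (m i)) :
    (E.pilOps l).comp m h (E.orbitPathAct x f) (fun i => E.orbitPathAct (y i) (g i)) =
      E.orbitPathAct ((E.orbitPathOps hC).comp m h x y)
        ((E.pilOps l).comp (fun i => m ((π k x.1).unop.symm i)) (sum_perm_eq h _) f
          (fun i => g ((π k x.1).unop.symm i))) := by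
  refine (RepresentsPi.comp m h (.self _) fun i => .self _).eq
    (.act (.comp hC m h (.self x) fun i => .self (y i))
      (.comp (fun i => m ((π k x.1).unop.symm i)) (sum_perm_eq h _) (.self f)
        fun i => .self (g ((π k x.1).unop.symm i)))
      (hC.samePi_equivariant m h x.1 (fun i => (y i).1) f g)) rfl ?_
  exact .of_eq (C.loopCompQ_transportPi m h _ _ _ _)

/-! ### Transport to groups along multiplicative bijections -/

variable {H : ℕ → Type v} [∀ n, Group (H n)] (φ : ∀ n, E.OrbitPath G n ≃ H n)
  (hφ : ∀ n x y, φ n (E.orbitPathMul x y) = φ n x * φ n y)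

/-- An idempotent of a group is its identity, so this is all that is needed to identify the operad
unit after transport. -/
theorem orbitPathOps_one_mul_one :
    E.orbitPathMul (E.orbitPathOps hC).one (E.orbitPathOps hC).one = (E.orbitPathOps hC).one := by
  have h1 : (E.orbitPathOps hC).one.1 = 1 := rfl
  refine (Represents.mul (.one hC) (.one hC) (r := .refl C.ops.one) ?_).eq (.one hC) (one_mul 1)
    rfl rfl (.of_eq (Path.Homotopic.Quotient.refl_trans _))
  rw [smulPath_refl, h1, one_smul]
  exact .refl _

include hP hφ in
theorem isGroupOperad_transport :
    IsGroupOperad ((E.orbitPathOps hC).transport φ) (fun k a => π k ((φ k).symm a).1) where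
  isOperad := (E.isOperad_orbitPathOps hC hP).transport φ
  map_mul a b := by
    rw [← hP.map_mul]
    refine congrArg (π _) ?_
    rw [← (φ _).apply_symm_apply a, ← (φ _).apply_symm_apply b, ← hφ]
    simp only [Equiv.symm_apply_apply]
    rfl
  map_unit := by
    refine Eq.trans ?_ hP.map_unit
    rw [hP.unit_eq]
    exact congrArg (fun x => π 1 x.1) ((φ 1).symm_apply_apply _)
  map_comp m N h a b := by
    refine Eq.trans ?_ (hP.map_comp m h _ _)
    exact congrArg (fun x => π _ x.1) ((φ _).symm_apply_apply _)
  unit_eq := by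
    have := hφ 1 (E.orbitPathOps hC).one (E.orbitPathOps hC).one
    rw [E.orbitPathOps_one_mul_one hC] at this
    exact (mul_eq_left.1 this.symm)
  crossed m N h a a' b b' := by
    have hsymm : ∀ n (a b : H n),
        (φ n).symm (a * b) = E.orbitPathMul ((φ n).symm a) ((φ n).symm b) := fun n a b => by
      rw [Equiv.symm_apply_eq, hφ, Equiv.apply_symm_apply, Equiv.apply_symm_apply]
    simp only [OperadOps.transport, hsymm]
    rw [E.orbitPathOps_crossed hC m h hP, hφ]

theorem isGOperad_transport {Y : ℕ → Type v} (ψ : ∀ n, E.pil l n ≃ Y n)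
    (act : ∀ n, H n → Y n → Y n) (one_act : ∀ n x, act n 1 x = x)
    (mul_act : ∀ n a b x, act n (a * b) x = act n a (act n b x))
    (hact : ∀ n x f, act n (φ n x) (ψ n f) = ψ n (E.orbitPathAct x f)) :
    IsGOperad ((E.orbitPathOps hC).transport φ) (fun k a => π k ((φ k).symm a).1)
      ((E.pilOps l).transport ψ) act where
  isOperad := (E.isOperad_pilOps l).transport ψ
  one_act := one_act _
  mul_act := mul_act _
  equivariant m N h σ τ a b := by
    have hsymm : ∀ n (σ : H n) (a : Y n),
        (ψ n).symm (act n σ a) = E.orbitPathAct ((φ n).symm σ) ((ψ n).symm a) := fun n σ a => by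
      rw [Equiv.symm_apply_eq, ← hact, Equiv.apply_symm_apply, Equiv.apply_symm_apply]
    simp only [OperadOps.transport, hsymm, hact]
    rw [E.pilOps_equivariant hC m h]

end GoodBasepoint

end Action

/-! ### Covering maps and homotopy groups -/

section Covering

variable {X : Type u} {Y : Type v} [TopologicalSpace X] [TopologicalSpace Y] {p : C(X, Y)} {l : ℕ}

/-- Homotopies relative to the boundary lift. For l ≥ 1 the boundary is nonempty, and it provides a
point where the two lifts agree. -/
theorem IsCoveringMap.injective_piMap (cov : IsCoveringMap p) (hl : 1 ≤ l) (x : X) :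
    Function.Injective (piMap (l := l) p x) := by
  intro f g hfg
  obtain ⟨f, rfl⟩ := exists_genLoop_mk f
  obtain ⟨g, rfl⟩ := exists_genLoop_mk g
  have h0 : (fun _ => 0 : Fin l → unitInterval) ∈ Cube.boundary (Fin l) :=
    ⟨⟨0, hl⟩, Or.inl rfl⟩
  refine Quotient.sound ((cov.homotopicRel_iff_comp ⟨_, h0, ?_⟩).2 (Quotient.exact hfg))
  exact (f.2 _ h0).trans (g.2 _ h0).symm

/-- A lift of a constant path is constant, so it suffices to join each boundary point to the corner
0 inside the boundary. This is possible because there are two distinct coordinates. -/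
theorem IsCoveringMap.const_on_boundary (cov : IsCoveringMap p) (hl : 2 ≤ l)
    {f : (Fin l → unitInterval) → X} (hf : Continuous f) {y : Y}
    (hy : ∀ t ∈ Cube.boundary (Fin l), p (f t) = y) {t : Fin l → unitInterval}
    (ht : t ∈ Cube.boundary (Fin l)) : f t = f fun _ => 0 := by
  have along : ∀ g : unitInterval → Fin l → unitInterval, Continuous g →
      (∀ r, g r ∈ Cube.boundary (Fin l)) → f (g 1) = f (g 0) := fun g hg hb =>
    cov.const_of_comp (hf.comp hg) (fun r r' => (hy _ (hb r)).trans (hy _ (hb r')).symm) 1 0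
  obtain ⟨i, hi⟩ := ht
  have : Nontrivial (Fin l) := Fin.nontrivial_iff_two_le.2 hl
  obtain ⟨j, hj⟩ := exists_ne i
  -- Within the face through t on which the i-th coordinate is fixed, the other coordinates shrink
  -- to 0.
  have h1 := along (fun r a => if a = i then t a else r * t a)
    (continuous_pi fun a => by split_ifs <;> fun_prop) fun r => ⟨i, by simpa using hi⟩
  -- Now the j-th coordinate is 0, so the i-th may shrink without leaving the boundary.
  have h2 := along (fun r a => if a = i then r * t a else 0)
    (continuous_pi fun a => by split_ifs <;> fun_prop) fun r => ⟨j, by simp [hj]⟩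
  simp only [one_mul, ite_self, zero_mul] at h1 h2
  exact h1.trans h2

theorem IsCoveringMap.surjective_piMap (cov : IsCoveringMap p) (hl : 2 ≤ l) (x : X) :
    Function.Surjective (piMap (l := l) p x) := by
  intro g
  obtain ⟨g, rfl⟩ := exists_genLoop_mk g
  have h0 : (fun _ => 0 : Fin l → unitInterval) ∈ Cube.boundary (Fin l) :=
    ⟨⟨0, by omega⟩, Or.inl rfl⟩
  -- Radial contraction to the corner 0: a homotopy from the constant map to g, so its lift starting
  -- at the constant map x ends at a lift of g.
  let H : C(unitInterval × (Fin l → unitInterval), Y) :=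
    ⟨fun a => g fun i => a.1 * a.2 i, g.1.continuous.comp (by fun_prop)⟩
  have H0 : ∀ t, H (0, t) = p (ContinuousMap.const _ x t) := fun t => by
    change g (fun i => 0 * t i) = p x
    simp only [zero_mul]
    exact g.2 _ h0
  let F := cov.liftHomotopy H (.const _ x) H0
  have hF : ∀ a, p (F a) = H a := congrFun (cov.liftHomotopy_lifts H (.const _ x) H0)
  have hp : ∀ t, p (F (1, t)) = g t := fun t => by
    rw [hF]
    change g (fun i => 1 * t i) = g t
    simp only [one_mul]
  -- The corner does not move under the contraction, so its lifted track is constant.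
  have hbase : F (1, fun _ => 0) = x := by
    refine Eq.trans ?_ (cov.liftHomotopy_zero H (.const _ x) H0 fun _ => 0)
    refine cov.const_of_comp (g := fun s => F (s, fun _ => 0)) (by fun_prop) (fun s s' => ?_) 1 0
    rw [hF, hF]
    change g (fun i => s * 0) = g (fun i => s' * 0)
    simp only [mul_zero]
  refine ⟨Quotient.mk _ ⟨⟨fun t => F (1, t), by fun_prop⟩, fun t ht => ?_⟩, ?_⟩
  · exact (cov.const_on_boundary hl (f := fun t => F (1, t)) (by fun_prop)
      (fun t ht => (hp t).trans (g.2 t ht)) ht).trans hbase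
  · exact congrArg (Quotient.mk _) (GenLoop.ext _ _ hp)

end Covering

/-! ### The covering of the orbit space -/

namespace SymmTopOperad

variable {C : SymmTopOperad.{u}}

/-- The fibres are the orbits by construction, and the covering hypothesis is precisely the required
disjointness. -/
theorem IsCovering.isQuotientCoveringMap (hcov : C.IsCovering) (k : ℕ) :
    IsQuotientCoveringMap (C.quot k) (SG k) where
  toIsQuotientMap := isQuotientMap_quotient_mk'
  toContinuousConstSMul := inferInstance
  apply_eq_iff_mem_orbit := Quotient.eq''
  disjoint := hcov k

variable (E : GoodBasepoint C.toTopOperad) {k : ℕ}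

theorem samePath_projPi1 (x : C.liftedPi1 E k) :
    SamePath (C.projPi1 E k x) (x.2.map (C.quot k)) := SamePath.cast _ _ _

theorem samePath_map_quot_smulPath {x y : C.obj k} (σ : SG k) (p : Path.Homotopic.Quotient x y) :
    SamePath ((smulPath σ p).map (C.quot k)) (p.map (C.quot k)) := by
  obtain ⟨p, rfl⟩ := Path.Homotopic.Quotient.mk_surjective p
  exact .mk fun t => C.quot_smul σ (p t)

theorem samePi_piMap_quot_smulPi {l : ℕ} {x : C.obj k} (σ : SG k) (f : π_ l (C.obj k) x) :
    SamePi (piMap (C.quot k) _ (smulPi σ f)) (piMap (C.quot k) _ f) := by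
  obtain ⟨f, rfl⟩ := exists_genLoop_mk f
  exact .mk (C.quot_smul σ x) fun t => C.quot_smul σ (f t)

/-- A translated path has the same image in the orbit space as the path itself. -/
theorem projPi1_orbitPathMul (x y : C.liftedPi1 E k) :
    C.projPi1 E k (E.orbitPathMul x y) = C.projPi1 E k x * C.projPi1 E k y := by
  refine SamePath.eq ((samePath_projPi1 E _).trans ((SamePath.of_eq
    (Path.Homotopic.Quotient.map_trans _ _ _)).trans ?_))
  refine SamePath.comp (samePath_projPi1 E x).symm ?_
  exact ((SamePath.cast _ rfl (mul_smul _ _ _)).map _).trans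
    ((samePath_map_quot_smulPath x.1 y.2).trans (samePath_projPi1 E y).symm)

/-- Monodromy recovers the endpoint σ e_k from the image, freeness of the action recovers σ, and
unique lifting of homotopies recovers the class of the path. -/
theorem IsCovering.injective_projPi1 (hcov : C.IsCovering) :
    Function.Injective (C.projPi1 E k) := by
  have hq := hcov.isQuotientCoveringMap k
  have cov := hq.isCoveringMap
  intro x y hxy
  have hmon : ∀ z : C.liftedPi1 E k, cov.monodromy (C.projPi1 E k z) ⟨E.e k, rfl⟩ =
      ⟨z.1 • E.e k, C.quot_smul z.1 (E.e k)⟩ := fun z => by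
    refine cov.monodromy_eq_of_map_eq z.2 ?_
    exact ((SamePath.cast _ _ _).trans (samePath_projPi1 E z)).symm.eq
  have hsmul : x.1 • E.e k = y.1 • E.e k :=
    congrArg Subtype.val ((hmon x).symm.trans ((congrArg (cov.monodromy · _) hxy).trans (hmon y)))
  have := hq.isCancelSMul
  obtain ⟨σ, x⟩ := x
  obtain ⟨τ, y⟩ := y
  obtain rfl : σ = τ := IsCancelSMul.right_cancel _ _ _ hsmul
  refine congrArg (Sigma.mk σ) (cov.injective_path_homotopic_map _ _ ?_)
  exact ((samePath_projPi1 E ⟨σ, x⟩).symm.trans ((SamePath.of_eq hxy).trans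
    (samePath_projPi1 E ⟨σ, y⟩))).eq

/-- A loop lifts to a path starting at e_k; its endpoint lies in the same fibre, hence in the orbit
of e_k. -/
theorem IsCovering.surjective_projPi1 (hcov : C.IsCovering) :
    Function.Surjective (C.projPi1 E k) := by
  have hq := hcov.isQuotientCoveringMap k
  have cov := hq.isCoveringMap
  intro γ
  let b : C.quot k ⁻¹' {C.quot k (E.e k)} := ⟨E.e k, rfl⟩
  obtain ⟨σ, hσ⟩ := hq.apply_eq_iff_mem_orbit.1 (cov.monodromy γ b).2
  refine ⟨⟨σ, (cov.liftPathQuotient γ b).cast rfl hσ⟩, SamePath.eq ?_⟩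
  refine (samePath_projPi1 E _).trans (((SamePath.cast _ rfl hσ).map _).trans ?_)
  exact (SamePath.of_eq (cov.map_liftPathQuotient γ b)).trans (SamePath.cast _ _ _)

end SymmTopOperad

/-! ### The group operad without symmetries -/

namespace TrivialAction

/-- The group operad of trivial groups. -/
def ops : OperadOps fun _ => Unit where
  comp _ _ _ _ _ := ()
  one := ()

theorem isGroupOperad_ops : IsGroupOperad ops (fun _ _ => 1) where
  isOperad :=
    { zero_unique := ⟨inferInstance⟩
      assoc := fun _ _ _ _ _ _ _ _ _ _ _ _ => rfl
      one_comp := fun _ _ => rfl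
      comp_one := fun _ _ => rfl }
  map_mul _ _ := (one_mul _).symm
  map_unit := rfl
  map_comp m _ h _ _ := (symOps_comp_one m h).symm
  unit_eq := rfl
  crossed _ _ _ _ _ _ _ := rfl

/-- The action of the trivial group. -/
@[reducible]
def mulAction (X : Type*) : MulAction Unit X where
  smul _ x := x
  one_smul _ := rfl
  mul_smul _ _ _ := rfl

attribute [local instance] mulAction

theorem continuousConstSMul (X : Type*) [TopologicalSpace X] : ContinuousConstSMul Unit X :=
  ⟨fun _ => continuous_id⟩

attribute [local instance] continuousConstSMul

variable (C : TopOperad.{u})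

theorem isGOperad : IsGOperad ops (fun _ _ => 1) C.ops (fun n (σ : Unit) (x : C.obj n) => σ • x) where
  isOperad := C.isOperad
  one_act _ := rfl
  mul_act _ _ _ := rfl
  equivariant _ _ _ _ _ _ _ := rfl

variable {C} (E : GoodBasepoint C)

/-- Paths to points of the orbit are loops when the group is trivial. -/
def orbitPathEquiv (k : ℕ) : E.OrbitPath (fun _ => Unit) k ≃ E.pi1 k where
  toFun x := x.2
  invFun p := ⟨(), p⟩
  left_inv _ := rfl
  right_inv _ := rfl

theorem samePath_smulPath {k : ℕ} {x y : C.obj k} (σ : Unit) (p : Path.Homotopic.Quotient x y) :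
    SamePath (smulPath (G := fun _ => Unit) σ p) p := SamePath.map_id p _ fun _ => rfl

theorem orbitPathEquiv_mul (k : ℕ) (x y : E.OrbitPath (fun _ => Unit) k) :
    orbitPathEquiv E k (E.orbitPathMul x y) = orbitPathEquiv E k x * orbitPathEquiv E k y :=
  SamePath.eq (SamePath.comp (.refl x.2) ((SamePath.cast _ _ _).trans (samePath_smulPath _ _)))

theorem transport_orbitPathOps :
    (E.orbitPathOps (isGOperad C)).transport (orbitPathEquiv E) = E.pi1Ops := by
  have h1 : ∀ {k : ℕ} (m : Fin k → ℕ) {N : ℕ} (h : N = ∑ i, m i) (f : E.pi1 k)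
      (g : ∀ i, E.pi1 (m i)), ((E.orbitPathOps (isGOperad C)).transport (orbitPathEquiv E)).comp
        m h f g = E.pi1Ops.comp m h f g := fun m N h f g => by
    let δ : Path.Homotopic.Quotient _ _ := .symm (.mk (E.δ m h))
    exact (SamePath.comp (.refl ((Path.Homotopic.Quotient.mk (E.δ m h)).trans
      (C.pathCompQ m h f g))) ((SamePath.cast (smulPath (C := C) (G := fun _ => Unit) () δ)
        rfl rfl).trans (samePath_smulPath () δ))).eq
  have h2 : ((E.orbitPathOps (isGOperad C)).transport (orbitPathEquiv E)).one = E.pi1Ops.one :=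
    SamePath.eq (SamePath.cast (.refl (E.e 1)) rfl rfl)
  -- With both structures replaced by variables, their equality splits into `h1` and `h2`.
  generalize (E.orbitPathOps (isGOperad C)).transport (orbitPathEquiv E) = O at h1 h2
  generalize E.pi1Ops = O' at h1 h2
  cases O
  cases O'
  congr
  funext k m N h f g
  exact h1 m h f g

theorem isGroupOperad_pi1Ops : IsGroupOperad E.pi1Ops (fun _ _ => 1) := by
  rw [← transport_orbitPathOps]
  exact E.isGroupOperad_transport (isGOperad C) isGroupOperad_ops (orbitPathEquiv E)
    (orbitPathEquiv_mul E)

theorem isGOperad_pilOps (l : ℕ) :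
    IsGOperad E.pi1Ops (fun _ _ => 1) (E.pilOps l) (fun _ a f => piAct a f) := by
  rw [← transport_orbitPathOps]
  refine E.isGOperad_transport (isGOperad C) (orbitPathEquiv E) (fun _ => Equiv.refl _)
    (fun _ a f => piAct a f) (fun _ => transportPi_refl) (fun _ => transportPi_trans)
    fun k x f => ?_
  exact (SamePi.transportPi (.refl _) (SamePi.piMap_id f _ fun _ => rfl)).symm.eq

end TrivialAction

/-! ### The main theorem -/

theorem mainTheorem8 :
    (∀ (C : TopOperad.{u}) (E : GoodBasepoint C), C.IsPathConnected →
      IsGroupOperad E.pi1Ops (fun _ _ => 1) ∧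
      ∀ l : ℕ, 1 ≤ l →
        IsGOperad E.pi1Ops (fun _ _ => 1) (E.pilOps l) (fun _ a f => piAct a f)) ∧
    (∀ (C : SymmTopOperad.{u}) (E : GoodBasepoint C.toTopOperad), C.IsPathConnected →
      C.IsCovering →
      ∃ φ : ∀ k, C.liftedPi1 E k ≃ C.pi1 E k,
        (∀ k x, φ k x = C.projPi1 E k x) ∧
        IsGroupOperad ((C.liftedPi1Ops E).transport φ) (fun k a => ((φ k).symm a).1) ∧
        ∀ l : ℕ, 1 < l →
          ∃ ψ : ∀ k, E.pil l k ≃ C.pil E l k,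
            (∀ k x, ψ k x = piMap (C.quot k) (E.e k) x) ∧
            IsGOperad ((C.liftedPi1Ops E).transport φ) (fun k a => ((φ k).symm a).1)
              ((E.pilOps l).transport ψ) (fun _ a f => piAct a f)) := by
  refine ⟨fun C E _ => ⟨TrivialAction.isGroupOperad_pi1Ops E,
    fun l _ => TrivialAction.isGOperad_pilOps E l⟩, fun C E _ hcov => ?_⟩
  have hbij := fun k =>
    And.intro (hcov.injective_projPi1 E (k := k)) (hcov.surjective_projPi1 E (k := k))
  -- `C.liftedPi1Ops E` unfolds to the general operations for 𝒮 acting on C, so the transport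
  -- results apply directly.
  refine ⟨fun k => Equiv.ofBijective _ (hbij k), fun k x => rfl,
    E.isGroupOperad_transport C.isGOperad isGroupOperad_symOps _
      fun k => C.projPi1_orbitPathMul E, fun l hl => ?_⟩
  have hcover := fun k => (hcov.isQuotientCoveringMap k).isCoveringMap
  refine ⟨fun k => Equiv.ofBijective _ ⟨(hcover k).injective_piMap hl.le (E.e k),
    (hcover k).surjective_piMap hl (E.e k)⟩, fun k x => rfl,
    E.isGOperad_transport C.isGOperad _ _ _ (fun _ => transportPi_refl)
      (fun _ => transportPi_trans) fun k x f => ?_⟩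
  -- With q the quotient map, the class of q ∘ p acts on q_* f by change of basepoint along q ∘ p.
  -- Since q_* f = q_*(σf), the result is the image under q of σf moved along p.
  refine SamePi.eq (SamePi.trans ?_ (.of_eq (piMap_transportPi (C.quot k) x.2 _).symm))
  exact .transportPi (C.samePath_projPi1 E x) (C.samePi_piMap_quot_smulPi x.1 f).symm
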